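/- A discrete pair is a pair of measures \(\omega=\sum_{i=1}^n\omega_i\delta_{x_i}\), \(v=\sum_{i=1}^n v_i\delta_{x_i}\) with \(n\in\{0,1,2,\dots\}\), \(x_1<\dots<x_n\) real, \(\omega_i\in\mathbb R\), \(v_i\ge 0\) and \(|\omega_i|+v_i>0\). Consider \(-f''+\tfrac14 f=z\omega f+z^2vf\) on \(\mathbb R\), meaning: \(f\) is continuous, \(f''=\tfrac14 f\) off the \(x_i\), and \(f'(x_i-)=f'(x_i+)+(z\omega_i+z^2v_i)f(x_i)\) for all \(i\). Its eigenvalues are the \(z\in\mathbb C\) for which there is a nontrivial bounded solution; they are real and finite in number, say \(\lambda_1<\dots<\lambda_N\). Let \(\phi_+(z,\cdot)\) be the solution that equals \(e^{-x/2}\) for all \(x\) near \(+\infty\), and put \[\gamma_i^2=\int|\phi_+(\lambda_i,\cdot)|^2\,d\omega+2\lambda_i\int|\phi_+(\lambda_i,\cdot)|^2\,dv,\qquad \varphi_i(x)=\frac{\phi_+(\lambda_i,x)}{\sqrt{\lambda_i\gamma_i^2}} .\] The vector \((\lambda_1,\dots,\lambda_N,\lambda_1\gamma_1^2,\dots,\lambda_N\gamma_N^2)\in\mathbb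 R^{2N}\) is called the spectral data of \((\omega,v)\). **Theorem.** Let \(a\in\mathbb R\), let \((\omega,v)\) be a discrete pair with \(\lambda_i,\varphi_i\) \((1\le i\le N)\) as above, and let \(k\) be the number of indices \(i\) with \(\varphi_i(a)=0\). Put \[\alpha=1-\sum_{i=1}^N|\varphi_i(a)|^2,\qquad \beta=-\sum_{i=1}^N\lambda_i|\varphi_i(a)|^2 .\] Consider the family of all discrete pairs \((\tilde\omega,\tilde v)\) (with any number of nodes) that have exactly the eigenvalues \(\lambda_1,\dots,\lambda_N\) and satisfy \(|\tilde\varphi_i(a)|=|\varphi_i(a)|\) for \(i=1,\dots,N\), and let \(\mathcal S\subset\mathbb R^{2N}\) be the set of the spectral data of its members. If \(k\ge1\), the family is infinite. Moreover, \(\mathcal S\) is a collection of \(2^m\) disjoint manifolds of dimension \(k\), that is, the union of \(2^m\) pairwise disjoint, nonempty, connected, relatively open subsets of \(\mathcal S\), each a \(k\)-dimensional embedded \(C^\infty\) submanifold of \(\mathbb R^{2N}\), where 1. \(m=N-2k-2\ge 0\) if \(\alpha=\beta=0\); 2. \(m=N-2k-1\ge 0\) if \(\alpha=0\) and \(\beta\ne0\);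 3. \(m=N-2k\ge 0\) if \(\alpha\ne0\). -/

import Mathlib

open Filter Topology

/-- A pair of discrete measures `ω = ∑ ωᵢ δ_{xᵢ}` (real) and `v = ∑ vᵢ δ_{xᵢ}` (nonnegative) on the
line, with `x₁ < ⋯ < xₙ` and `|ωᵢ| + vᵢ > 0`. The ordering and the last condition make the nodes and
weights unique, so two different terms of this type are two different pairs of measures. -/
@[ext]
structure DiscretePair where
  n : ℕ
  x : Fin n → ℝ
  ω : Fin n → ℝ
  v : Fin n → ℝ
  x_strictMono : StrictMono x
  v_nonneg : ∀ i, 0 ≤ v i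
  weight_pos : ∀ i, 0 < |ω i| + v i

namespace DiscretePair

/-- `f` is a (distributional) solution of `-f'' + f / 4 = z ω f + z² v f` on the line. -/
def IsSolution (H : DiscretePair) (z : ℂ) (f : ℝ → ℂ) : Prop :=
  Continuous f ∧
  (∀ y, y ∉ Set.range H.x → DifferentiableAt ℝ f y ∧ HasDerivAt (deriv f) (f y / 4) y) ∧
  ∀ i, ∃ p q : ℂ, Tendsto (deriv f) (𝓝[<] H.x i) (𝓝 p) ∧ Tendsto (deriv f) (𝓝[>] H.x i) (𝓝 q) ∧
    p = q + z * (H.ω i : ℂ) * f (H.x i) + z ^ 2 * (H.v i : ℂ) * f (H.x i)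

/-- The spectrum: all `z` for which there is a nontrivial bounded solution. -/
def spectrum (H : DiscretePair) : Set ℂ :=
  {z | ∃ f : ℝ → ℂ, H.IsSolution z f ∧ f ≠ 0 ∧ ∃ C : ℝ, ∀ y, ‖f y‖ ≤ C}

/-- `f` is a solution equal to `e^{-x/2}` for all `x` near `+∞`. -/
def IsPhiPlus (H : DiscretePair) (z : ℂ) (f : ℝ → ℂ) : Prop :=
  H.IsSolution z f ∧ ∀ᶠ y : ℝ in atTop, f y = Complex.exp (-(y : ℂ) / 2)

/-- The hyperbolic sine ramp to the left of `s`. -/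
noncomputable def ramp (s y : ℝ) : ℂ := ((Real.sinh (max (s - y) 0 / 2) : ℝ) : ℂ)

/-- The derivative of the ramp away from `s`. -/
noncomputable def ramp' (s y : ℝ) : ℂ := if y < s then ((-(Real.cosh ((s - y) / 2)) / 2 : ℝ) : ℂ) else 0

theorem ramp_of_le {s y : ℝ} (h : y ≤ s) : ramp s y = ((Real.sinh ((s - y) / 2) : ℝ) : ℂ) := by
  rw [ramp, max_eq_left (by linarith)]

theorem ramp_of_ge {s y : ℝ} (h : s ≤ y) : ramp s y = 0 := by
  rw [ramp, max_eq_right (by linarith)]; simp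

theorem continuous_ramp (s : ℝ) : Continuous (ramp s) := by
  unfold ramp
  exact Complex.continuous_ofReal.comp
    (Real.continuous_sinh.comp ((((continuous_const.sub continuous_id).max continuous_const)).div_const 2))

theorem hasDerivAt_lin (s y : ℝ) : HasDerivAt (fun t : ℝ => (s - t) / 2) (-1 / 2) y :=
  ((hasDerivAt_id y).const_sub s).div_const 2

theorem hasDerivAt_ramp {s y : ℝ} (h : y ≠ s) : HasDerivAt (ramp s) (ramp' s y) y := by
  rcases lt_or_gt_of_ne h with h | h
  · rw [ramp', if_pos h]
    have h1 : HasDerivAt (fun t : ℝ => Real.sinh ((s - t) / 2)) (-(Real.cosh ((s - y) / 2)) / 2) y := by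
      refine ((Real.hasDerivAt_sinh _).comp y (hasDerivAt_lin s y)).congr_deriv ?_
      ring
    refine h1.ofReal_comp.congr_of_eventuallyEq ?_
    filter_upwards [Iio_mem_nhds h] with t ht
    exact ramp_of_le (le_of_lt ht)
  · rw [ramp', if_neg (not_lt.2 h.le)]
    refine (hasDerivAt_const y (0 : ℂ)).congr_of_eventuallyEq ?_
    filter_upwards [Ioi_mem_nhds h] with t ht
    exact ramp_of_ge (le_of_lt ht)

theorem hasDerivAt_ramp' {s y : ℝ} (h : y ≠ s) : HasDerivAt (ramp' s) (ramp s y / 4) y := by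
  rcases lt_or_gt_of_ne h with h | h
  · rw [ramp_of_le h.le]
    have h1 : HasDerivAt (fun t : ℝ => -(Real.cosh ((s - t) / 2)) / 2) (Real.sinh ((s - y) / 2) / 4) y := by
      refine ((((Real.hasDerivAt_cosh _).comp y (hasDerivAt_lin s y)).neg).div_const 2).congr_deriv ?_
      ring
    have h2 := h1.ofReal_comp
    push_cast at h2 ⊢
    refine h2.congr_of_eventuallyEq ?_
    filter_upwards [Iio_mem_nhds h] with t ht
    rw [ramp', if_pos (Set.mem_Iio.1 ht)]; push_cast; rfl
  · rw [ramp_of_ge h.le, zero_div]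
    refine (hasDerivAt_const y (0 : ℂ)).congr_of_eventuallyEq ?_
    filter_upwards [Ioi_mem_nhds h] with t ht
    rw [ramp', if_neg (not_lt.2 (le_of_lt (Set.mem_Ioi.1 ht)))]

theorem tendsto_ramp'_left (s : ℝ) : Tendsto (ramp' s) (𝓝[<] s) (𝓝 (-1 / 2)) := by
  have h : Continuous (fun t : ℝ => ((-(Real.cosh ((s - t) / 2)) / 2 : ℝ) : ℂ)) := by
    have : Continuous fun t : ℝ => Real.cosh ((s - t) / 2) :=
      Real.continuous_cosh.comp ((continuous_const.sub continuous_id).div_const 2)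
    exact Complex.continuous_ofReal.comp (this.neg.div_const 2)
  have h2 := (h.tendsto s).mono_left (nhdsWithin_le_nhds (s := Set.Iio s))
  simp only [sub_self, zero_div, Real.cosh_zero] at h2
  push_cast at h2
  refine h2.congr' ?_
  filter_upwards [self_mem_nhdsWithin] with t ht
  rw [ramp', if_pos (Set.mem_Iio.1 ht)]; push_cast; rfl

theorem tendsto_ramp'_right (s : ℝ) : Tendsto (ramp' s) (𝓝[>] s) (𝓝 0) := by
  refine tendsto_const_nhds.congr' ?_
  filter_upwards [self_mem_nhdsWithin] with t ht
  rw [ramp', if_neg (not_lt.2 (le_of_lt (Set.mem_Ioi.1 ht)))]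

/-- The coefficients of `φ₊(z, ·)` in `e^{-x/2}` and the ramps, from the right-most node on. -/
noncomputable def coef (H : DiscretePair) (z : ℂ) (i : Fin H.n) : ℂ :=
  (z * (H.ω i : ℂ) + z ^ 2 * (H.v i : ℂ)) * (Complex.exp (-(H.x i : ℂ) / 2) -
    2 * ∑ j ∈ (Finset.Ioi i).attach, H.coef z j.1 * ramp (H.x j.1) (H.x i))
termination_by H.n - i.1
decreasing_by
  have h0 := Finset.mem_Ioi.1 j.2
  have h1 : i.1 < j.1.1 := h0
  omega

/-- A closed form of `φ₊(z, ·)`. -/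
noncomputable def phiAux (H : DiscretePair) (z : ℂ) (y : ℝ) : ℂ :=
  Complex.exp (-(y : ℂ) / 2) - 2 * ∑ j, H.coef z j * ramp (H.x j) y

theorem coef_eq (H : DiscretePair) (z : ℂ) (i : Fin H.n) :
    H.coef z i = (z * (H.ω i : ℂ) + z ^ 2 * (H.v i : ℂ)) * H.phiAux z (H.x i) := by
  rw [coef, phiAux]
  congr 3
  rw [Finset.sum_attach (Finset.Ioi i) (fun j => H.coef z j * ramp (H.x j) (H.x i))]
  refine Finset.sum_subset (Finset.subset_univ _) fun j _ hj => ?_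
  rw [Finset.mem_Ioi, not_lt] at hj
  rw [ramp_of_ge (H.x_strictMono.monotone hj), mul_zero]

/-- The derivative of `phiAux` away from the nodes. -/
noncomputable def phiAux' (H : DiscretePair) (z : ℂ) (y : ℝ) : ℂ :=
  -Complex.exp (-(y : ℂ) / 2) / 2 - 2 * ∑ j, H.coef z j * ramp' (H.x j) y

theorem hasDerivAt_exp_half (y : ℝ) :
    HasDerivAt (fun t : ℝ => Complex.exp (-(t : ℂ) / 2)) (-Complex.exp (-(y : ℂ) / 2) / 2) y := by
  have h : HasDerivAt (fun t : ℝ => -(t : ℂ) / 2) (-1 / 2) y :=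
    ((hasDerivAt_id y).ofReal_comp.neg).div_const 2
  refine h.cexp.congr_deriv ?_
  ring

theorem hasDerivAt_phiAux (H : DiscretePair) (z : ℂ) {y : ℝ} (hy : y ∉ Set.range H.x) :
    HasDerivAt (H.phiAux z) (H.phiAux' z y) y := by
  refine (hasDerivAt_exp_half y).sub (HasDerivAt.const_mul 2 (HasDerivAt.fun_sum fun j _ => ?_))
  exact (hasDerivAt_ramp fun h => hy ⟨j, h.symm⟩).const_mul _

theorem hasDerivAt_phiAux' (H : DiscretePair) (z : ℂ) {y : ℝ} (hy : y ∉ Set.range H.x) :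
    HasDerivAt (H.phiAux' z) (H.phiAux z y / 4) y := by
  have h1 : HasDerivAt (fun t : ℝ => -Complex.exp (-(t : ℂ) / 2) / 2)
      (Complex.exp (-(y : ℂ) / 2) / 4) y := by
    refine ((hasDerivAt_exp_half y).neg.div_const 2).congr_deriv ?_
    ring
  have h2 : HasDerivAt (fun t => 2 * ∑ j, H.coef z j * ramp' (H.x j) t)
      (2 * ∑ j, H.coef z j * (ramp (H.x j) y / 4)) y :=
    HasDerivAt.const_mul 2 (HasDerivAt.fun_sum fun j _ =>
      (hasDerivAt_ramp' fun h => hy ⟨j, h.symm⟩).const_mul _)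
  refine (h1.sub h2).congr_deriv ?_
  rw [phiAux, sub_div]
  congr 1
  rw [mul_div_assoc, Finset.sum_div]
  simp only [mul_div_assoc]

theorem isOpen_compl_nodes (H : DiscretePair) : IsOpen (Set.range H.x)ᶜ :=
  (Set.finite_range H.x).isClosed.isOpen_compl

/-- Punctured neighbourhoods contain no nodes. -/
theorem eventually_not_node (H : DiscretePair) (y : ℝ) : ∀ᶠ t in 𝓝[≠] y, t ∉ Set.range H.x := by
  have h : (Set.range H.x \ {y})ᶜ ∈ 𝓝 y :=
    ((Set.finite_range H.x).subset Set.sdiff_subset).isClosed.isOpen_compl.mem_nhds (by simp)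
  filter_upwards [nhdsWithin_le_nhds h, self_mem_nhdsWithin] with t ht1 ht2 ht3
  exact ht1 ⟨ht3, ht2⟩

theorem isPhiPlus_phiAux (H : DiscretePair) (z : ℂ) : H.IsPhiPlus z (H.phiAux z) := by
  have hd : ∀ y, y ∉ Set.range H.x → deriv (H.phiAux z) y = H.phiAux' z y :=
    fun y hy => (H.hasDerivAt_phiAux z hy).deriv
  refine ⟨⟨?_, ?_, ?_⟩, ?_⟩
  · unfold phiAux
    refine (by fun_prop : Continuous fun y : ℝ => Complex.exp (-(y : ℂ) / 2)).sub
      (continuous_const.mul (continuous_finsetSum _ fun j _ => continuous_const.mul (continuous_ramp _)))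
  · intro y hy
    refine ⟨(H.hasDerivAt_phiAux z hy).differentiableAt, ?_⟩
    refine (H.hasDerivAt_phiAux' z hy).congr_of_eventuallyEq ?_
    filter_upwards [H.isOpen_compl_nodes.mem_nhds hy] with t ht
    exact hd t ht
  · intro i
    have he : Continuous fun y : ℝ => -Complex.exp (-(y : ℂ) / 2) / 2 := by fun_prop
    have hcont : ∀ j, j ≠ i → ContinuousAt (ramp' (H.x j)) (H.x i) := fun j hj =>
      (hasDerivAt_ramp' fun h => hj (H.x_strictMono.injective h).symm).continuousAt
    have hL : Tendsto (H.phiAux' z) (𝓝[<] H.x i) (𝓝 (-Complex.exp (-(H.x i : ℂ) / 2) / 2 -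
        2 * ∑ j, H.coef z j * (if j = i then -1 / 2 else ramp' (H.x j) (H.x i)))) := by
      refine ((he.tendsto _).mono_left nhdsWithin_le_nhds).sub
        (Tendsto.const_mul 2 (tendsto_finsetSum _ fun j _ => Tendsto.const_mul _ ?_))
      split_ifs with h
      · subst h; exact tendsto_ramp'_left _
      · exact (hcont j h).tendsto.mono_left nhdsWithin_le_nhds
    have hR : Tendsto (H.phiAux' z) (𝓝[>] H.x i) (𝓝 (-Complex.exp (-(H.x i : ℂ) / 2) / 2 -
        2 * ∑ j, H.coef z j * (if j = i then 0 else ramp' (H.x j) (H.x i)))) := by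
      refine ((he.tendsto _).mono_left nhdsWithin_le_nhds).sub
        (Tendsto.const_mul 2 (tendsto_finsetSum _ fun j _ => Tendsto.const_mul _ ?_))
      split_ifs with h
      · subst h; exact tendsto_ramp'_right _
      · exact (hcont j h).tendsto.mono_left nhdsWithin_le_nhds
    have hnode := H.eventually_not_node (H.x i)
    refine ⟨_, _, hL.congr' ?_, hR.congr' ?_, ?_⟩
    · filter_upwards [nhdsWithin_mono _ (fun t (ht : t < H.x i) => ht.ne) hnode] with t ht
      exact (hd t ht).symm
    · filter_upwards [nhdsWithin_mono _ (fun t (ht : H.x i < t) => ht.ne') hnode] with t ht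
      exact (hd t ht).symm
    · have h1 : ∑ j, H.coef z j * (if j = i then -1 / 2 else ramp' (H.x j) (H.x i)) =
          ∑ j, H.coef z j * (if j = i then 0 else ramp' (H.x j) (H.x i)) - H.coef z i / 2 := by
        have h3 : ∀ j, H.coef z j * (if j = i then -1 / 2 else ramp' (H.x j) (H.x i)) =
            H.coef z j * (if j = i then 0 else ramp' (H.x j) (H.x i)) -
              (if j = i then H.coef z j / 2 else 0) := by
          intro j
          split_ifs <;> ring
        rw [Finset.sum_congr rfl fun j _ => h3 j, Finset.sum_sub_distrib,
          Finset.sum_ite_eq' Finset.univ i, if_pos (Finset.mem_univ i)]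
      have h2 := H.coef_eq z i
      rw [h1]
      linear_combination h2
  · have : ∀ᶠ y : ℝ in atTop, ∀ j, H.x j ≤ y := eventually_all.2 fun j => eventually_ge_atTop _
    filter_upwards [this] with y hy
    rw [phiAux, Finset.sum_eq_zero fun j _ => by rw [ramp_of_ge (hy j), mul_zero]]
    simp

theorem IsSolution.sub {H : DiscretePair} {z : ℂ} {f g : ℝ → ℂ} (hf : H.IsSolution z f)
    (hg : H.IsSolution z g) : H.IsSolution z (fun y => f y - g y) := by
  have hd : ∀ y, y ∉ Set.range H.x → deriv (fun y => f y - g y) y = deriv f y - deriv g y :=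
    fun y hy => deriv_fun_sub (hf.2.1 y hy).1 (hg.2.1 y hy).1
  refine ⟨hf.1.sub hg.1, fun y hy => ⟨(hf.2.1 y hy).1.sub (hg.2.1 y hy).1, ?_⟩, fun i => ?_⟩
  · rw [sub_div]
    refine ((hf.2.1 y hy).2.sub (hg.2.1 y hy).2).congr_of_eventuallyEq ?_
    filter_upwards [H.isOpen_compl_nodes.mem_nhds hy] with t ht
    exact hd t ht
  · obtain ⟨p, q, h1, h2, h3⟩ := hf.2.2 i
    obtain ⟨p', q', h1', h2', h3'⟩ := hg.2.2 i
    have hnode := H.eventually_not_node (H.x i)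
    refine ⟨p - p', q - q', (h1.sub h1').congr' ?_, (h2.sub h2').congr' ?_, ?_⟩
    · filter_upwards [nhdsWithin_mono _ (fun t (ht : t < H.x i) => ht.ne) hnode] with t ht
      exact (hd t ht).symm
    · filter_upwards [nhdsWithin_mono _ (fun t (ht : H.x i < t) => ht.ne') hnode] with t ht
      exact (hd t ht).symm
    · linear_combination h3 - h3'

theorem IsSolution.eq_zero {H : DiscretePair} {z : ℂ} {d : ℝ → ℂ} (hd : H.IsSolution z d)
    (h0 : ∀ᶠ y in atTop, d y = 0) : ∀ y, d y = 0 := by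
  by_contra! hne
  obtain ⟨t, ht⟩ := hne
  set S : Set ℝ := {y | ∀ s, y ≤ s → d s = 0} with hS
  obtain ⟨b, hb⟩ := eventually_atTop.1 h0
  have hbS : b ∈ S := fun s hs => hb s hs
  have hlow : ∀ y ∈ S, t ≤ y := fun y hy => le_of_not_gt fun h => ht (hy t h.le)
  have hbdd : BddBelow S := ⟨t, hlow⟩
  set y0 := sInf S with hy0
  have hright : ∀ s, y0 < s → d s = 0 := by
    intro s hs
    obtain ⟨y, hyS, hys⟩ := exists_lt_of_csInf_lt ⟨b, hbS⟩ hs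
    exact hyS s hys.le
  have hdy0 : d y0 = 0 := by
    have h1 : Tendsto d (𝓝[>] y0) (𝓝 (d y0)) := (hd.1.tendsto y0).mono_left nhdsWithin_le_nhds
    refine tendsto_nhds_unique h1 (tendsto_const_nhds.congr' ?_)
    filter_upwards [self_mem_nhdsWithin] with s hs
    exact (hright s hs).symm
  have hderR : Tendsto (deriv d) (𝓝[>] y0) (𝓝 0) := by
    refine tendsto_const_nhds.congr' ?_
    filter_upwards [self_mem_nhdsWithin] with s hs
    have : d =ᶠ[𝓝 s] fun _ => 0 := by
      filter_upwards [Ioi_mem_nhds hs] with r hr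
      exact hright r hr
    rw [this.deriv_eq, deriv_const]
  have hderL : Tendsto (deriv d) (𝓝[<] y0) (𝓝 0) := by
    by_cases hn : y0 ∈ Set.range H.x
    · obtain ⟨i, hi⟩ := hn
      obtain ⟨p, q, h1, h2, h3⟩ := hd.2.2 i
      rw [hi] at h1 h2 h3
      have hq : q = 0 := tendsto_nhds_unique h2 hderR
      rw [hdy0, hq] at h3
      simp only [mul_zero, add_zero] at h3
      rwa [h3] at h1
    · have hc := (hd.2.1 y0 hn).2.continuousAt.tendsto
      have h1 : deriv d y0 = 0 := tendsto_nhds_unique (hc.mono_left nhdsWithin_le_nhds) hderR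
      rw [h1] at hc
      exact hc.mono_left nhdsWithin_le_nhds
  have hdL : Tendsto d (𝓝[<] y0) (𝓝 0) := by
    have := (hd.1.tendsto y0).mono_left (nhdsWithin_le_nhds (s := Set.Iio y0))
    rwa [hdy0] at this
  have hev : ∀ᶠ s in 𝓝[<] y0, s ∉ Set.range H.x :=
    nhdsWithin_mono _ (fun t (ht : t < y0) => ht.ne) (H.eventually_not_node y0)
  obtain ⟨l, hl, hIoo⟩ := (mem_nhdsLT_iff_exists_Ioo_subset).1 hev
  have key : ∀ σ : ℂ, σ ^ 2 = 1 / 4 → ∀ s ∈ Set.Ioo l y0, deriv d s + σ * d s = 0 := by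
    intro σ hσ s hs
    have hconst : ∀ r ∈ Set.Ioo l y0,
        HasDerivAt (fun r : ℝ => (deriv d r + σ * d r) * Complex.exp (-σ * (r : ℂ))) 0 r := by
      intro r hr
      have h1 := (hd.2.1 r (hIoo hr)).2
      have h2 := (hd.2.1 r (hIoo hr)).1.hasDerivAt
      have h3 : HasDerivAt (fun r : ℝ => Complex.exp (-σ * (r : ℂ)))
          (Complex.exp (-σ * (r : ℂ)) * (-σ * 1)) r :=
        (((hasDerivAt_id r).ofReal_comp).const_mul (-σ)).cexp
      refine ((h1.add (h2.const_mul σ)).mul h3).congr_deriv ?_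
      simp only [Pi.add_apply]
      linear_combination -(d r * Complex.exp (-σ * (r : ℂ))) * hσ
    have heq : ∀ r ∈ Set.Ioo l y0, (deriv d r + σ * d r) * Complex.exp (-σ * (r : ℂ)) =
        (deriv d s + σ * d s) * Complex.exp (-σ * (s : ℂ)) := by
      intro r hr
      exact isOpen_Ioo.is_const_of_deriv_eq_zero isPreconnected_Ioo
        (fun r hr => (hconst r hr).differentiableAt.differentiableWithinAt)
        (fun r hr => (hconst r hr).deriv) hr hs
    have hexp : Tendsto (fun r : ℝ => Complex.exp (-σ * (r : ℂ))) (𝓝[<] y0)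
        (𝓝 (Complex.exp (-σ * (y0 : ℂ)))) :=
      ((by fun_prop : Continuous fun r : ℝ => Complex.exp (-σ * (r : ℂ))).tendsto y0).mono_left
        nhdsWithin_le_nhds
    have hlim := (hderL.add (hdL.const_mul σ)).mul hexp
    have hlim2 : Tendsto (fun r : ℝ => (deriv d r + σ * d r) * Complex.exp (-σ * (r : ℂ))) (𝓝[<] y0)
        (𝓝 ((deriv d s + σ * d s) * Complex.exp (-σ * (s : ℂ)))) := by
      refine tendsto_const_nhds.congr' ?_
      filter_upwards [Ioo_mem_nhdsLT hl] with r hr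
      exact (heq r hr).symm
    have h5 := tendsto_nhds_unique hlim2 hlim
    simp only [mul_zero, add_zero, zero_mul] at h5
    exact (mul_eq_zero.1 h5).resolve_right (Complex.exp_ne_zero _)
  have hzero : ∀ s ∈ Set.Ioo l y0, d s = 0 := by
    intro s hs
    have h1 := key (1 / 2) (by norm_num) s hs
    have h2 := key (-1 / 2) (by norm_num) s hs
    linear_combination h1 - h2
  have hmem : (l + y0) / 2 ∈ S := by
    intro s hs
    have hl' : l < y0 := hl
    rcases lt_trichotomy s y0 with h | h | h
    · exact hzero s ⟨by linarith, h⟩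
    · rw [h, hdy0]
    · exact hright s h
  have h6 := csInf_le hbdd hmem
  have hl' : l < y0 := hl
  linarith

theorem existsUnique_phiPlus (H : DiscretePair) (z : ℂ) : ∃! f, H.IsPhiPlus z f := by
  refine ⟨H.phiAux z, H.isPhiPlus_phiAux z, fun g hg => funext fun y => ?_⟩
  have h := (hg.1.sub (H.isPhiPlus_phiAux z).1).eq_zero (by
    filter_upwards [hg.2, (H.isPhiPlus_phiAux z).2] with t h1 h2
    rw [h1, h2, sub_self]) y
  exact sub_eq_zero.1 h

/-- `φ₊(z, ·)`, the unique solution equal to `e^{-x/2}` near `+∞`. -/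
noncomputable def phiPlus (H : DiscretePair) (z : ℂ) : ℝ → ℂ := (H.existsUnique_phiPlus z).choose

/-- `γ_μ² = ∫ |φ₊(μ, ·)|² dω + 2 μ ∫ |φ₊(μ, ·)|² dv`. -/
noncomputable def gammaSq (H : DiscretePair) (μ : ℝ) : ℝ :=
  (∑ i, ‖H.phiPlus μ (H.x i)‖ ^ 2 * H.ω i) + 2 * μ * ∑ i, ‖H.phiPlus μ (H.x i)‖ ^ 2 * H.v i

/-- The normalized eigenfunction `φ₊(μ, ·) / √(μ γ_μ²)` of an eigenvalue `μ`. -/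
noncomputable def normEigenfun (H : DiscretePair) (μ : ℝ) (y : ℝ) : ℂ :=
  H.phiPlus μ y / (Real.sqrt (μ * H.gammaSq μ) : ℂ)

/-- `lam` lists all eigenvalues, `λ₁ < ⋯ < λ_N`. -/
def HasEigenvalues (H : DiscretePair) {N : ℕ} (lam : Fin N → ℝ) : Prop :=
  StrictMono lam ∧ Set.range (fun i => (lam i : ℂ)) = H.spectrum

/-- All pairs with eigenvalues `lam i` whose normalized eigenfunctions at `a` have absolute
value `r i`. -/
def inverseFamily (a : ℝ) {N : ℕ} (lam r : Fin N → ℝ) : Set DiscretePair :=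
  {K | K.HasEigenvalues lam ∧ ∀ i, ‖K.normEigenfun (lam i) a‖ = r i}

/-- The set of spectral data `(λ₁, …, λ_N, λ₁ γ₁², …, λ_N γ_N²)` of the pairs in the inverse
family. -/
def inverseFamilyData (a : ℝ) {N : ℕ} (lam r : Fin N → ℝ) : Set ((Fin N → ℝ) × (Fin N → ℝ)) :=
  (fun K : DiscretePair => (lam, fun i => lam i * K.gammaSq (lam i))) '' inverseFamily a lam r

end DiscretePair

/-- `S` is a `k`-dimensional embedded smooth submanifold of `E`: near each of its points a smooth
chart of `E` carries `S` to a `k`-dimensional linear subspace. -/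
def IsEmbeddedSubmanifold {E : Type*} [NormedAddCommGroup E] [NormedSpace ℝ E]
    [FiniteDimensional ℝ E] (k : ℕ)
    (S : Set E) : Prop :=
  ∀ p ∈ S, ∃ (V : Submodule ℝ E) (Φ : OpenPartialHomeomorph E E),
    Module.finrank ℝ V = k ∧ p ∈ Φ.source ∧
    ContDiffOn ℝ (⊤ : ℕ∞) Φ Φ.source ∧ ContDiffOn ℝ (⊤ : ℕ∞) Φ.symm Φ.target ∧
    Φ '' (S ∩ Φ.source) = (V : Set E) ∩ Φ.target

/-- `S` is a collection of `m` disjoint manifolds of dimension `k`: the `m` pieces are nonempty and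
connected, and each is open in `S` (so they are the connected components of `S`). -/
def IsDisjointManifolds {E : Type*} [NormedAddCommGroup E] [NormedSpace ℝ E]
    [FiniteDimensional ℝ E] (m k : ℕ)
    (S : Set E) : Prop :=
  ∃ M : Fin m → Set E, S = ⋃ j, M j ∧ (∀ i j, i ≠ j → Disjoint (M i) (M j)) ∧
    ∀ j, IsConnected (M j) ∧ IsEmbeddedSubmanifold k (M j) ∧ ∃ U, IsOpen U ∧ M j = S ∩ U

/-! The whole problem becomes one about real polynomials with simple real zeros. Up to exponential
factors, the solution `φ₊(z, ·)` to the left of finitely many nodes is a pair of polynomials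
(`sol`), and its quotient of slope and value is a rational Herglotz function `B / A = ∑ t μ / (μ -
z)` with `t μ > 0`. Conversely, every such function comes from exactly one list of nodes, by
expanding it into a Stieltjes continued fraction whose partial quotients are gaps and weights
(`stieltjes_step`, `exists_nodeList`, `sol_injective`).

Cut the line at `a`. The right and left half lines have Weyl functions with denominators `A_R`,
`A_L` (zero sets `MR`, `ML`) and residues `tR`, `tL`; between them sits a possible node at `a` with
weights `w`, `v`. The characteristic polynomial is `W = A_R A_L - X (B_R A_L + B_L A_R + (w + v X)
A_R A_L)`, so it depends only on `MR ∩ ML`, `MR ∪ ML`, the sum `tR + tL`, `w` and `v`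
(`charPoly_eq_mul`). Moreover `A_R A_L / W` is, up to normalization, the diagonal Green function at
`a`, with `A_R A_L / W = α + ∑ λᵢ |φᵢ(a)|² / (λᵢ - z)`. Hence the prescribed data fix the product
`A_R A_L` (`mul_eq_mul`), and with it the intersection and the union of the two zero sets. The
intersection consists of the `k` eigenvalues whose eigenfunction vanishes at `a`.

What remains free is how the poles are shared between the two half lines. A pole outside the
intersection belongs wholly to one side, a binary choice. At a common pole the total residue is
divided in an arbitrary positive ratio, one real parameter. In spectral data, the binary choices fix
`λᵢ γᵢ²` wherever `φᵢ(a) ≠ 0`, and the ratios make the other `k` numbers range over all of `(0, ∞)`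
(`mem_orthantPiece`, `exists_of_mem_orthantPiece`). So the data set is a disjoint union of open
`k`-dimensional orthants, one for each subset of the symmetric difference. Its size is `deg (A_R
A_L) - 2k`, and the displayed expansion gives degree `N`, `N - 1` or `N - 2` according to whether
`α` and `β` vanish (`card_add_card_eq`). -/

namespace KreinString

/-! ### Polynomials with simple real zeros and partial fractions -/

open Polynomial

/-- The polynomial with value `1` at `0` and simple roots at the points of `M`. -/
noncomputable def rootPoly (M : Finset ℝ) : ℝ[X] := ∏ μ ∈ M, (1 - C μ⁻¹ * X)

/-- The numerator of `∑ t μ / (μ - X)` over the denominator `rootPoly M`. -/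
noncomputable def residuePoly (M : Finset ℝ) (t : ℝ → ℝ) : ℝ[X] :=
  ∑ μ ∈ M, C (t μ * μ⁻¹) * rootPoly (M.erase μ)

section RootPoly

variable {M : Finset ℝ} {t : ℝ → ℝ}

theorem rootPoly_eq_mul_erase {μ : ℝ} (hμ : μ ∈ M) :
    rootPoly M = (1 - C μ⁻¹ * X) * rootPoly (M.erase μ) :=
  (Finset.mul_prod_erase M (fun μ => (1 - C μ⁻¹ * X : ℝ[X])) hμ).symm

theorem rootPoly_mul_of_disjoint {M' : Finset ℝ} (h : Disjoint M M') :
    rootPoly (M ∪ M') = rootPoly M * rootPoly M' := Finset.prod_union h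

@[simp] theorem rootPoly_empty : rootPoly ∅ = 1 := by simp [rootPoly]

@[simp] theorem residuePoly_empty : residuePoly ∅ t = 0 := by simp [residuePoly]

theorem eval_zero_rootPoly : (rootPoly M).eval 0 = 1 := by
  simp [rootPoly, eval_prod]

theorem aeval_rootPoly_eq_zero (h0 : 0 ∉ M) {z : ℂ} :
    aeval z (rootPoly M) = 0 ↔ ∃ μ ∈ M, z = μ := by
  rw [rootPoly, map_prod, Finset.prod_eq_zero_iff]
  refine exists_congr fun μ => and_congr_right fun hμ => ?_
  have hμ0 : (μ : ℂ) ≠ 0 := by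
    rintro h; rw [Complex.ofReal_eq_zero] at h; exact h0 (h ▸ hμ)
  simp only [map_sub, map_one, map_mul, aeval_C, aeval_X, Complex.coe_algebraMap, Complex.ofReal_inv]
  constructor
  · intro h
    field_simp at h
    linear_combination -h
  · rintro rfl
    field_simp
    ring

theorem eval_rootPoly_eq_zero (h0 : 0 ∉ M) {x : ℝ} : (rootPoly M).eval x = 0 ↔ x ∈ M := by
  have h := aeval_rootPoly_eq_zero h0 (z := (x : ℂ))
  rw [← Complex.coe_algebraMap, aeval_algebraMap_apply, Complex.coe_algebraMap,
    Complex.ofReal_eq_zero, coe_aeval_eq_eval] at h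
  rw [h]
  constructor
  · rintro ⟨μ, hμ, h⟩
    rwa [Complex.ofReal_inj.1 h]
  · exact fun h => ⟨x, h, rfl⟩

theorem rootPoly_ne_zero : rootPoly M ≠ 0 := by
  intro h
  have := eval_zero_rootPoly (M := M)
  simp [h] at this

theorem natDegree_rootPoly (h0 : 0 ∉ M) : (rootPoly M).natDegree = M.card := by
  have h1 : ∀ μ ∈ M, (1 - C μ⁻¹ * X : ℝ[X]).natDegree = 1 := by
    intro μ hμ
    have hμ0 : μ⁻¹ ≠ 0 := inv_ne_zero fun h => h0 (h ▸ hμ)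
    have : (1 - C μ⁻¹ * X : ℝ[X]) = C (-μ⁻¹) * X + C 1 := by rw [C_neg, C_1]; ring
    rw [this, natDegree_linear (neg_ne_zero.2 hμ0)]
  rw [rootPoly, natDegree_prod _ _ fun μ hμ h => ?_, Finset.sum_congr rfl h1]
  · simp
  · have := h1 μ hμ
    simp [h] at this

theorem degree_rootPoly (h0 : 0 ∉ M) : (rootPoly M).degree = M.card := by
  rw [degree_eq_natDegree rootPoly_ne_zero, natDegree_rootPoly h0]

theorem roots_rootPoly (h0 : 0 ∉ M) : (rootPoly M).roots = M.val := by
  have hle : M.val ≤ (rootPoly M).roots :=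
    (Multiset.le_iff_subset M.nodup).2 fun μ hμ =>
      (mem_roots rootPoly_ne_zero).2 ((eval_rootPoly_eq_zero h0).2 hμ)
  refine (Multiset.eq_of_le_of_card_le hle ?_).symm
  exact (card_roots' _).trans (natDegree_rootPoly h0).le

theorem eval_rootPoly_erase_ne_zero (h0 : 0 ∉ M) {μ : ℝ} :
    (rootPoly (M.erase μ)).eval μ ≠ 0 := by
  rw [Ne, eval_rootPoly_eq_zero fun h => h0 (Finset.mem_of_mem_erase h)]
  exact Finset.notMem_erase μ M

theorem eval_derivative_rootPoly (h0 : 0 ∉ M) {μ : ℝ} (hμ : μ ∈ M) :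
    (derivative (rootPoly M)).eval μ = -μ⁻¹ * (rootPoly (M.erase μ)).eval μ := by
  have hμ0 : μ ≠ 0 := fun h => h0 (h ▸ hμ)
  rw [rootPoly_eq_mul_erase hμ]
  simp [hμ0]

theorem eval_derivative_rootPoly_ne_zero (h0 : 0 ∉ M) {μ : ℝ} (hμ : μ ∈ M) :
    (derivative (rootPoly M)).eval μ ≠ 0 := by
  rw [eval_derivative_rootPoly h0 hμ]
  exact mul_ne_zero (neg_ne_zero.2 (inv_ne_zero fun h => h0 (h ▸ hμ)))
    (eval_rootPoly_erase_ne_zero h0)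

theorem eval_residuePoly (h0 : 0 ∉ M) {μ : ℝ} (hμ : μ ∈ M) :
    (residuePoly M t).eval μ = -t μ * (derivative (rootPoly M)).eval μ := by
  rw [eval_derivative_rootPoly h0 hμ, residuePoly, eval_finsetSum,
    Finset.sum_eq_single_of_mem μ hμ]
  · simp; ring
  · intro ν hν hne
    have : (rootPoly (M.erase ν)).eval μ = 0 :=
      (eval_rootPoly_eq_zero fun h => h0 (Finset.mem_of_mem_erase h)).2
        (Finset.mem_erase.2 ⟨hne.symm, hμ⟩)
    simp [this]

theorem natDegree_residuePoly_le (h0 : 0 ∉ M) : (residuePoly M t).natDegree ≤ M.card - 1 := by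
  refine natDegree_sum_le_of_forall_le _ _ fun μ hμ => (natDegree_C_mul_le _ _).trans ?_
  rw [natDegree_rootPoly fun h => h0 (Finset.mem_of_mem_erase h), Finset.card_erase_of_mem hμ]

theorem degree_residuePoly_lt (h0 : 0 ∉ M) : (residuePoly M t).degree < M.card := by
  rcases M.eq_empty_or_nonempty with rfl | hM
  · simp
  · have h := natDegree_residuePoly_le h0 (t := t)
    refine degree_le_natDegree.trans_lt ?_
    have := hM.card_pos
    exact_mod_cast (by omega : (residuePoly M t).natDegree < M.card)

/-- The asymptotics of `∑ t μ / (μ - X)` at infinity, which is `-(∑ t μ) / X` to leading order. It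
later supplies the degree drop and sign in the continued fraction, and the role of `β`. -/
theorem coeff_residuePoly (h0 : 0 ∉ M) :
    (residuePoly M t).coeff (M.card - 1) = -(∑ μ ∈ M, t μ) * (rootPoly M).coeff M.card := by
  rw [residuePoly, finsetSum_coeff, neg_mul, Finset.sum_mul, ← Finset.sum_neg_distrib]
  refine Finset.sum_congr rfl fun μ hμ => ?_
  have hc : M.card = (M.card - 1) + 1 := by
    have := Finset.card_pos.2 ⟨μ, hμ⟩
    omega
  have hd : (rootPoly (M.erase μ)).natDegree = M.card - 1 := by
    rw [natDegree_rootPoly fun h => h0 (Finset.mem_of_mem_erase h), Finset.card_erase_of_mem hμ]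
  have h1 : (rootPoly M).coeff M.card = -μ⁻¹ * (rootPoly (M.erase μ)).coeff (M.card - 1) := by
    rw [rootPoly_eq_mul_erase hμ, sub_mul, one_mul, coeff_sub, mul_assoc, coeff_C_mul]
    rw [hc, coeff_X_mul, coeff_eq_zero_of_natDegree_lt (by rw [hd]; omega)]
    simp
  rw [h1, coeff_C_mul]
  ring

/-- Partial fractions as Lagrange interpolation: a numerator of degree below that of the denominator
is fixed by its values at the poles. -/
theorem eq_residuePoly (h0 : 0 ∉ M) {p : ℝ[X]} (hp : p.degree < M.card)
    (h : ∀ μ ∈ M, p.eval μ = -t μ * (derivative (rootPoly M)).eval μ) : p = residuePoly M t :=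
  eq_of_degrees_lt_of_eval_finset_eq M hp (degree_residuePoly_lt h0) fun μ hμ => by
    rw [h μ hμ, eval_residuePoly h0 hμ]

theorem residuePoly_congr {t' : ℝ → ℝ} (h : ∀ μ ∈ M, t μ = t' μ) :
    residuePoly M t = residuePoly M t' :=
  Finset.sum_congr rfl fun μ hμ => by rw [h μ hμ]

theorem residuePoly_add (t' : ℝ → ℝ) :
    residuePoly M (fun μ => t μ + t' μ) = residuePoly M t + residuePoly M t' := by
  simp only [residuePoly, ← Finset.sum_add_distrib]
  refine Finset.sum_congr rfl fun μ _ => ?_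
  rw [add_mul, C_add, add_mul]

theorem residuePoly_smul (c : ℝ) :
    residuePoly M (fun μ => c * t μ) = C c * residuePoly M t := by
  simp only [residuePoly, Finset.mul_sum]
  refine Finset.sum_congr rfl fun μ _ => ?_
  rw [mul_assoc c, C_mul, mul_assoc]

/-- Adding common factors to numerator and denominator. -/
theorem residuePoly_mul_rootPoly {M' : Finset ℝ} (hd : Disjoint M M') (ht : ∀ μ ∈ M', t μ = 0) :
    residuePoly M t * rootPoly M' = residuePoly (M ∪ M') t := by
  rw [residuePoly, residuePoly, Finset.sum_union hd,
    Finset.sum_eq_zero (s := M') fun μ hμ => by simp [ht μ hμ], add_zero, Finset.sum_mul]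
  refine Finset.sum_congr rfl fun μ hμ => ?_
  rw [Finset.erase_union_distrib, Finset.erase_eq_of_notMem (Finset.disjoint_left.1 hd hμ),
    rootPoly_mul_of_disjoint (hd.mono_left (Finset.erase_subset _ _)), mul_assoc]

end RootPoly

/-! ### Rational Herglotz functions -/

/-- `B / A` is strictly increasing on the line and maps the upper half plane to itself. -/
structure IsHerglotz (A B : ℝ[X]) : Prop where
  im_pos : ∀ z : ℂ, 0 < z.im → 0 < (aeval z B * (starRingEnd ℂ) (aeval z A)).im
  wronskian_pos : ∀ x : ℝ, 0 < (derivative B).eval x * A.eval x - B.eval x * (derivative A).eval x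

/-- After clearing denominators, each simple fraction contributes a nonnegative multiple of
`|E_μ|²`, where `E_μ` is the denominator without the factor of `μ`. On the real line, at a pole the
term of that pole is strictly positive; elsewhere every term is. -/
theorem isHerglotz_rootPoly {M : Finset ℝ} {t : ℝ → ℝ} (h0 : 0 ∉ M) (hM : M.Nonempty)
    (ht : ∀ μ ∈ M, 0 < t μ) : IsHerglotz (rootPoly M) (residuePoly M t) := by
  have hpos : ∀ μ ∈ M, 0 < t μ * μ⁻¹ ^ 2 := fun μ hμ =>
    mul_pos (ht μ hμ) (sq_pos_iff.2 (inv_ne_zero fun h => h0 (h ▸ hμ)))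
  have h0' : ∀ μ, 0 ∉ M.erase μ := fun μ h => h0 (Finset.mem_of_mem_erase h)
  constructor
  · intro z hz
    have key : (aeval z (residuePoly M t) * (starRingEnd ℂ) (aeval z (rootPoly M))).im =
        ∑ μ ∈ M, t μ * μ⁻¹ ^ 2 * (z.im * Complex.normSq (aeval z (rootPoly (M.erase μ)))) := by
      rw [residuePoly, map_sum, Finset.sum_mul, Complex.im_sum]
      refine Finset.sum_congr rfl fun μ hμ => ?_
      rw [rootPoly_eq_mul_erase hμ]
      generalize rootPoly (M.erase μ) = E
      simp only [map_sub, map_one, map_mul, aeval_C, aeval_X, Complex.coe_algebraMap,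
        Complex.conj_ofReal]
      have : ((t μ : ℝ) : ℂ) * ((μ⁻¹ : ℝ) : ℂ) * aeval z E *
          ((1 - ((μ⁻¹ : ℝ) : ℂ) * (starRingEnd ℂ) z) * (starRingEnd ℂ) (aeval z E)) =
          ((t μ * μ⁻¹ * Complex.normSq (aeval z E) : ℝ) : ℂ) *
            (1 - ((μ⁻¹ : ℝ) : ℂ) * (starRingEnd ℂ) z) := by
        rw [Complex.ofReal_mul, ← Complex.mul_conj, Complex.ofReal_mul]
        ring
      rw [this, Complex.im_ofReal_mul, Complex.sub_im, Complex.one_im, Complex.im_ofReal_mul,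
        Complex.conj_im]
      ring
    rw [key]
    refine Finset.sum_pos (fun μ hμ => mul_pos (hpos μ hμ) (mul_pos hz ?_)) hM
    rw [Complex.normSq_pos, Ne, aeval_rootPoly_eq_zero (h0' μ)]
    rintro ⟨ν, -, rfl⟩
    simp at hz
  · intro x
    have key : (derivative (residuePoly M t)).eval x * (rootPoly M).eval x -
        (residuePoly M t).eval x * (derivative (rootPoly M)).eval x =
        ∑ μ ∈ M, t μ * μ⁻¹ ^ 2 * (rootPoly (M.erase μ)).eval x ^ 2 := by
      rw [residuePoly, derivative_sum, eval_finsetSum, eval_finsetSum, Finset.sum_mul,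
        Finset.sum_mul, ← Finset.sum_sub_distrib]
      refine Finset.sum_congr rfl fun μ hμ => ?_
      rw [rootPoly_eq_mul_erase hμ]
      generalize rootPoly (M.erase μ) = E
      simp
      ring
    rw [key]
    refine Finset.sum_pos' (fun μ hμ => mul_nonneg (hpos μ hμ).le (sq_nonneg _)) ?_
    by_cases hx : x ∈ M
    · exact ⟨x, hx, mul_pos (hpos x hx) (sq_pos_iff.2 (eval_rootPoly_erase_ne_zero h0))⟩
    · obtain ⟨μ, hμ⟩ := hM
      refine ⟨μ, hμ, mul_pos (hpos μ hμ) (sq_pos_iff.2  ?_)⟩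
      rw [Ne, eval_rootPoly_eq_zero (h0' μ)]
      exact fun h => hx (Finset.mem_of_mem_erase h)

namespace IsHerglotz

variable {A B : ℝ[X]}

theorem swap (h : IsHerglotz A B) : IsHerglotz B (-A) := by
  refine ⟨fun z hz => ?_, fun x => ?_⟩
  · have := h.im_pos z hz
    simp only [map_neg, Complex.mul_im, Complex.neg_im, Complex.neg_re, Complex.conj_im,
      Complex.conj_re] at this ⊢
    linarith
  · have := h.wronskian_pos x
    simp only [derivative_neg, eval_neg]
    linarith

theorem const_mul (h : IsHerglotz A B) {c : ℝ} (hc : c ≠ 0) : IsHerglotz (C c * A) (C c * B) := by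
  have hc2 : 0 < c ^ 2 := sq_pos_iff.2 hc
  refine ⟨fun z hz => ?_, fun x => ?_⟩
  · have := mul_pos hc2 (h.im_pos z hz)
    simp only [map_mul, aeval_C, Complex.coe_algebraMap, Complex.conj_ofReal]
    rw [← Complex.im_ofReal_mul] at this
    refine this.trans_eq (congrArg Complex.im ?_)
    push_cast
    ring
  · have := mul_pos hc2 (h.wronskian_pos x)
    simp only [derivative_C_mul, eval_mul, eval_C]
    linarith

theorem add_const_mul (h : IsHerglotz A B) (c : ℝ) : IsHerglotz A (B + C c * A) := by
  refine ⟨fun z hz => ?_, fun x => ?_⟩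
  · have := h.im_pos z hz
    simp only [map_add, map_mul, aeval_C, Complex.coe_algebraMap, add_mul, mul_assoc,
      Complex.mul_conj, Complex.add_im, Complex.im_ofReal_mul, Complex.ofReal_im]
    linarith
  · have := h.wronskian_pos x
    simp only [derivative_add, derivative_C_mul, eval_add, eval_mul, eval_C]
    linarith

theorem taylor (h : IsHerglotz A B) (s : ℝ) :
    IsHerglotz (Polynomial.taylor s A) (Polynomial.taylor s B) := by
  have hev : ∀ (z : ℂ) (p : ℝ[X]), aeval z (Polynomial.taylor s p) = aeval (z + s) p := by
    intro z p
    simp [taylor_apply, aeval_comp]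
  have hder : ∀ p : ℝ[X], derivative (Polynomial.taylor s p) =
      Polynomial.taylor s (derivative p) := by
    intro p
    simp [taylor_apply, derivative_comp]
  refine ⟨fun z hz => ?_, fun x => ?_⟩
  · rw [hev, hev]
    exact h.im_pos _ (by simpa using hz)
  · rw [hder, hder]
    simp only [taylor_eval]
    exact h.wronskian_pos _

/-- A zero of `A` would make the strictly positive imaginary part vanish; the lower half plane
follows by conjugation. This forces all zeros of `A` to be real. -/
theorem aeval_ne_zero (h : IsHerglotz A B) {z : ℂ} (hz : z.im ≠ 0) : aeval z A ≠ 0 := by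
  intro hA
  rcases hz.lt_or_gt with h1 | h1
  · have h2 := h.im_pos ((starRingEnd ℂ) z) (by simpa using h1)
    rw [show aeval ((starRingEnd ℂ) z) A = (starRingEnd ℂ) (aeval z A) from
      aeval_conj A z, hA] at h2
    simp at h2
  · have h2 := h.im_pos z h1
    rw [hA] at h2
    simp at h2

theorem ne_zero (h : IsHerglotz A B) : A ≠ 0 := by
  rintro rfl
  exact h.aeval_ne_zero (z := Complex.I) (by simp) (map_zero _)

theorem splits (h : IsHerglotz A B) : A.Splits := by
  refine Splits.of_splits_map (algebraMap ℝ ℂ) (IsAlgClosed.splits _) fun z hz => ?_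
  have hz' : aeval z A = 0 := by
    rw [mem_roots', IsRoot, eval_map_algebraMap] at hz
    exact hz.2
  have him : z.im = 0 := by
    by_contra hne
    exact h.aeval_ne_zero hne hz'
  exact ⟨z.re, Complex.ext (by simp) (by simp [him])⟩

/-- At a zero of `A` the Wronskian reduces to `-B A' > 0`, which gives simplicity of the zero and
positivity of the residue at once. -/
theorem exists_eq_rootPoly (h : IsHerglotz A B) (hA : A.eval 0 = 1) :
    ∃ M : Finset ℝ, 0 ∉ M ∧ A = rootPoly M ∧
      ∀ μ ∈ M, 0 < -B.eval μ / (derivative A).eval μ := by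
  have hroot : ∀ x, A.eval x = 0 → 0 < -B.eval x * (derivative A).eval x := by
    intro x hx
    have := h.wronskian_pos x
    rw [hx] at this
    linarith
  have hmem : ∀ x, x ∈ A.roots.toFinset ↔ A.eval x = 0 := by
    intro x
    rw [Multiset.mem_toFinset, mem_roots h.ne_zero, IsRoot]
  have h0 : (0 : ℝ) ∉ A.roots.toFinset := by
    rw [hmem, hA]
    exact one_ne_zero
  have hnd : A.roots.Nodup := by
    rw [Multiset.nodup_iff_count_le_one]
    intro x
    rw [count_roots]
    by_contra! hlt
    rw [one_lt_rootMultiplicity_iff_isRoot h.ne_zero] at hlt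
    have := hroot x hlt.1
    rw [hlt.2, mul_zero] at this
    exact lt_irrefl _ this
  have hcard : A.roots.toFinset.card = A.natDegree := by
    rw [Multiset.toFinset_card_of_nodup hnd, splits_iff_card_roots.1 h.splits]
  refine ⟨A.roots.toFinset, h0, ?_, fun μ hμ => ?_⟩
  -- Both polynomials have degree equal to the number of roots, so agreement at the roots and at the
  -- extra point `0` suffices.
  · have hlt : ∀ p : ℝ[X], p.natDegree = A.roots.toFinset.card →
        p.degree < (insert 0 A.roots.toFinset).card := by
      intro p hp
      rw [Finset.card_insert_of_notMem h0, ← hp]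
      refine degree_le_natDegree.trans_lt ?_
      exact_mod_cast Nat.lt_succ_self _
    refine eq_of_degrees_lt_of_eval_finset_eq _ (hlt _ hcard.symm) (hlt _ (natDegree_rootPoly h0)) ?_
    intro x hx
    rcases Finset.mem_insert.1 hx with rfl | hx
    · rw [hA, eval_zero_rootPoly]
    · rw [(hmem x).1 hx, (eval_rootPoly_eq_zero h0).2 hx]
  · have h1 := hroot μ ((hmem μ).1 hμ)
    have hne : (derivative A).eval μ ≠ 0 := by
      intro h2
      rw [h2, mul_zero] at h1
      exact lt_irrefl _ h1
    have h3 : -B.eval μ / (derivative A).eval μ =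
        -B.eval μ * (derivative A).eval μ / (derivative A).eval μ ^ 2 := by
      field_simp
    rw [h3]
    exact div_pos h1 (sq_pos_iff.2 hne)

/-- The remainder of `B` modulo `A` has the same residues. -/
theorem exists_remainder (h : IsHerglotz A B) (hA : A.eval 0 = 1) {q R : ℝ[X]}
    (hB : B = q * A + R) (hR : R.degree < A.degree) :
    ∃ (M : Finset ℝ) (t : ℝ → ℝ), 0 ∉ M ∧ (∀ μ ∈ M, 0 < t μ) ∧ (∀ μ ∉ M, t μ = 0) ∧
      A = rootPoly M ∧ R = residuePoly M t := by
  classical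
  obtain ⟨M, h0, rfl, ht⟩ := h.exists_eq_rootPoly hA
  refine ⟨M, fun μ => if μ ∈ M then -B.eval μ / (derivative (rootPoly M)).eval μ else 0, h0,
    fun μ hμ => ?_, fun μ hμ => by simp [hμ], rfl, ?_⟩
  · simp only [hμ, if_true]
    exact ht μ hμ
  · rw [degree_rootPoly h0] at hR
    refine eq_residuePoly h0 hR fun μ hμ => ?_
    have h1 : B.eval μ = R.eval μ := by
      rw [hB]
      simp [(eval_rootPoly_eq_zero h0).2 hμ]
    have h2 := eval_derivative_rootPoly_ne_zero h0 hμ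
    simp only [hμ, if_true, h1]
    field_simp

theorem remainder_of_eval_zero (h : IsHerglotz A B) (hA : A.eval 0 = 1) (hd : 0 < A.natDegree)
    {q R : ℝ[X]} (hB : B = q * A + R) (hR : R.degree < A.degree) :
    IsHerglotz A R ∧ R.natDegree + 1 = A.natDegree ∧ R.leadingCoeff * A.leadingCoeff < 0 := by
  obtain ⟨M, t, h0, ht, -, rfl, rfl⟩ := h.exists_remainder hA hB hR
  rw [natDegree_rootPoly h0] at hd ⊢
  have hM : M.Nonempty := Finset.card_pos.1 hd
  have hT : 0 < ∑ μ ∈ M, t μ := Finset.sum_pos ht hM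
  have hc := coeff_residuePoly h0 (t := t)
  have hlc : (rootPoly M).coeff M.card = (rootPoly M).leadingCoeff := by
    rw [leadingCoeff, natDegree_rootPoly h0]
  rw [hlc] at hc
  have hne : (rootPoly M).leadingCoeff ≠ 0 := leadingCoeff_ne_zero.2 rootPoly_ne_zero
  have hdeg : (residuePoly M t).natDegree = M.card - 1 := by
    refine le_antisymm (natDegree_residuePoly_le h0) (le_natDegree_of_ne_zero ?_)
    rw [hc]
    exact mul_ne_zero (neg_ne_zero.2 hT.ne') hne
  refine ⟨isHerglotz_rootPoly h0 hM ht, by omega, ?_⟩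
  rw [leadingCoeff, hdeg, hc, mul_assoc, neg_mul, neg_lt_zero, ← sq]
  exact mul_pos hT (sq_pos_iff.2 hne)

/-- Translation to a point where `A` does not vanish, and division by its value there, reduce to the
normalized case. The generality is needed because the continued fraction applies this to the pair
`(B, -A)`, where `B` may vanish at `0`. -/
theorem remainder (h : IsHerglotz A B) (hd : 0 < A.natDegree)
    {q R : ℝ[X]} (hB : B = q * A + R) (hR : R.degree < A.degree) :
    IsHerglotz A R ∧ R.natDegree + 1 = A.natDegree ∧ R.leadingCoeff * A.leadingCoeff < 0 := by
  obtain ⟨s, hs⟩ : ∃ s, A.eval s ≠ 0 := by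
    by_contra! hall
    exact h.ne_zero (funext fun x => by simp [hall x])
  set c := (A.eval s)⁻¹ with hc
  have hc0 : c ≠ 0 := inv_ne_zero hs
  have hnd : ∀ p : ℝ[X], (C c * Polynomial.taylor s p).natDegree = p.natDegree := fun p => by
    rw [natDegree_C_mul hc0, natDegree_taylor]
  have hdeg : ∀ p : ℝ[X], (C c * Polynomial.taylor s p).degree = p.degree := fun p => by
    rw [degree_C_mul hc0, degree_taylor]
  have hback : ∀ p : ℝ[X], C c⁻¹ * Polynomial.taylor (-s) (C c * Polynomial.taylor s p) = p := by
    intro p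
    rw [taylor_mul, taylor_C, taylor_taylor, ← mul_assoc, ← C_mul, inv_mul_cancel₀ hc0]
    simp
  obtain ⟨h1, h2, h3⟩ := ((h.taylor s).const_mul hc0).remainder_of_eval_zero
    (by simp [taylor_eval, hc, hs]) (by rw [hnd]; exact hd)
    (q := Polynomial.taylor s q) (R := C c * Polynomial.taylor s R)
    (by rw [hB]; simp only [map_add, taylor_mul]; ring)
    (by rw [hdeg, hdeg]; exact hR)
  refine ⟨?_, by rwa [hnd, hnd] at h2, ?_⟩
  · have := (h1.taylor (-s)).const_mul (inv_ne_zero hc0)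
    rwa [hback, hback] at this
  · simp only [leadingCoeff_mul, leadingCoeff_C, leadingCoeff_taylor] at h3
    have h4 : 0 < c ^ 2 := sq_pos_iff.2 hc0
    by_contra! hge
    have := mul_nonneg h4.le hge
    linarith

end IsHerglotz

/-- One step of the Stieltjes continued fraction. -/
theorem stieltjes_step {M : Finset ℝ} {t : ℝ → ℝ} (h0 : 0 ∉ M) (hM : M.Nonempty)
    (ht : ∀ μ ∈ M, 0 < t μ) :
    ∃ (l w v : ℝ) (M' : Finset ℝ) (t' : ℝ → ℝ), 0 < l ∧ 0 ≤ v ∧ 0 < |w| + v ∧ 0 ∉ M' ∧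
      (∀ μ ∈ M', 0 < t' μ) ∧ M'.card < M.card ∧
      residuePoly M t = (C w + C v * X) * rootPoly M' + residuePoly M' t' ∧
      rootPoly M = rootPoly M' - C l * X * residuePoly M t := by
  have hHP := isHerglotz_rootPoly h0 hM ht
  have hcard := hM.card_pos
  have hndA := natDegree_rootPoly h0
  obtain ⟨-, hnd, hlc⟩ := hHP.remainder (by omega) (q := 0) (R := residuePoly M t) (by simp)
    (by rw [degree_rootPoly h0]; exact degree_residuePoly_lt h0)
  have hA0 := eval_zero_rootPoly (M := M)
  set A := rootPoly M
  set B := residuePoly M t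
  have hB0 : B ≠ 0 := by rintro h; simp [h] at hlc
  have hlB : B.leadingCoeff ≠ 0 := leadingCoeff_ne_zero.2 hB0
  -- The gap length that cancels the leading terms, so that `g = A + l X B` has degree at most that
  -- of `B`.
  set l := -(A.leadingCoeff / B.leadingCoeff) with hl
  have hlpos : 0 < l := by
    have h1 : l = -(B.leadingCoeff * A.leadingCoeff) / B.leadingCoeff ^ 2 := by
      rw [hl]; field_simp
    rw [h1]
    exact div_pos (by linarith) (sq_pos_iff.2 hlB)
  set g := A + C l * X * B with hg
  have hg0 : g.eval 0 = 1 := by simp [hg, hA0]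
  have hgdeg : g.degree ≤ B.degree := by
    rw [degree_eq_natDegree hB0, degree_le_iff_coeff_zero]
    intro m hm
    have hm : B.natDegree < m := by exact_mod_cast hm
    obtain ⟨m, rfl⟩ : ∃ j, m = j + 1 := ⟨m - 1, by omega⟩
    rw [hg, coeff_add, mul_assoc, coeff_C_mul, coeff_X_mul]
    rcases (by omega : m = B.natDegree ∨ B.natDegree < m) with rfl | hm'
    · rw [hnd, coeff_natDegree, coeff_natDegree, hl]
      field_simp
      ring
    · rw [coeff_eq_zero_of_natDegree_lt hm', coeff_eq_zero_of_natDegree_lt (by omega)]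
      simp
  have hAg : A = g - C l * X * B := by rw [hg]; ring
  -- If `B` is constant, then `g = 1` and the expansion ends with a single node of weight `B`.
  rcases Nat.eq_zero_or_pos B.natDegree with hBz | hBpos
  · obtain ⟨b, hb⟩ := natDegree_eq_zero.1 hBz
    have hg1 : g = 1 := by
      have h1 : g.natDegree = 0 := by
        have := natDegree_le_natDegree hgdeg
        omega
      obtain ⟨c, hc⟩ := natDegree_eq_zero.1 h1
      rw [← hc] at hg0 ⊢
      simp at hg0
      simp [hg0]
    refine ⟨l, b, 0, ∅, t, hlpos, le_rfl, ?_, by simp, by simp, by simpa using hM, ?_, ?_⟩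
    · have : b ≠ 0 := by
        rintro rfl
        exact hB0 (by simpa using hb.symm)
      simpa using this
    · simp [hb]
    · rw [rootPoly_empty, ← hg1]; exact hAg
  · have hdiv : -A = (-A / B) * B + (-A % B) := by
      rw [mul_comm]; exact (EuclideanDomain.div_add_mod _ _).symm
    have hRdeg : (-A % B).degree < B.degree := EuclideanDomain.mod_lt _ hB0
    obtain ⟨hR1, hR2, hR3⟩ := hHP.swap.remainder hBpos hdiv hRdeg
    set q := -A / B
    set R := -A % B
    -- The linear part of the quotient of `-A` by `B` is `l X`, because `g` has no larger degree
    -- than `B`. Hence `-g = R + c B`, which exhibits `B / g` as a Herglotz function again.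
    obtain ⟨c, hc⟩ : ∃ c : ℝ, q - C l * X = C c := by
      have h1 : (q - C l * X) * B = -g - R := by
        rw [hg]; linear_combination -hdiv
      have h2 : ((q - C l * X) * B).degree ≤ B.degree := by
        rw [h1]
        refine (degree_sub_le _ _).trans (max_le ?_ hRdeg.le)
        rwa [degree_neg]
      refine ⟨_, eq_C_of_degree_le_zero ?_⟩
      rw [degree_mul] at h2
      by_contra! hlt
      have hBd := degree_eq_natDegree hB0
      rw [hBd] at h2
      by_cases hz : q - C l * X = 0
      · rw [hz] at hlt; simp at hlt
      · rw [degree_eq_natDegree hz] at h2 hlt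
        norm_cast at h2 hlt
        omega
    have hgR : -g = R + C c * B := by
      rw [← hc, hg]; linear_combination hdiv
    have hgHP : IsHerglotz g B := by
      have h1 := (hR1.add_const_mul c).swap
      rw [← hgR] at h1
      have h2 := h1.const_mul (c := -1) (by norm_num)
      simpa using h2
    have hgne := hgHP.ne_zero
    have hdiv2 : B = (B / g) * g + (B % g) := by
      rw [mul_comm]; exact (EuclideanDomain.div_add_mod _ _).symm
    have hRdeg2 : (B % g).degree < g.degree := EuclideanDomain.mod_lt _ hgne
    have hqdeg : (B / g).natDegree = B.natDegree - g.natDegree := by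
      have h1 := degree_add_div hgne hgdeg
      have h2 : B / g ≠ 0 := fun h => by
        rw [h, degree_zero, WithBot.add_bot] at h1
        exact hB0 (degree_eq_bot.1 h1.symm)
      rw [degree_eq_natDegree hgne, degree_eq_natDegree h2, degree_eq_natDegree hB0] at h1
      norm_cast at h1
      omega
    have hqlc : (B / g).leadingCoeff = B.leadingCoeff / g.leadingCoeff :=
      leadingCoeff_div hgdeg
    obtain ⟨M', t', h0', ht', -, hg', hR'⟩ := hgHP.exists_remainder hg0 hdiv2 hRdeg2
    have hgc : M'.card = g.natDegree := by rw [hg', natDegree_rootPoly h0']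
    have hgn := natDegree_le_natDegree hgdeg
    have hquot : ∃ w v : ℝ, 0 ≤ v ∧ 0 < |w| + v ∧ B / g = C w + C v * X := by
      -- If `c = 0`, then `g = -R` has degree one less than `B`, the quotient `B / g` is linear, and
      -- the signs of the leading coefficients give `v > 0`. Otherwise the degrees agree, and the
      -- quotient is a nonzero constant `w` with `v = 0`.
      by_cases hc0 : c = 0
      · rw [hc0, C_0, zero_mul, add_zero] at hgR
        have hgnd : g.natDegree = R.natDegree := by rw [← natDegree_neg, hgR]
        have hglc : g.leadingCoeff = -R.leadingCoeff := by
          rw [← hgR, leadingCoeff_neg, neg_neg]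
        have h1 : (B / g).natDegree = 1 := by omega
        have hv : 0 < (B / g).coeff 1 := by
          have : (B / g).coeff 1 = (B / g).leadingCoeff := by rw [leadingCoeff, h1]
          rw [this, hqlc, hglc]
          have hR0 : R.leadingCoeff ≠ 0 := by
            intro h; rw [h, zero_mul] at hR3; exact lt_irrefl _ hR3
          have : B.leadingCoeff / -R.leadingCoeff =
              -(R.leadingCoeff * B.leadingCoeff) / R.leadingCoeff ^ 2 := by
            field_simp
          rw [this]
          exact div_pos (by linarith) (sq_pos_iff.2 hR0)
        refine ⟨(B / g).coeff 0, (B / g).coeff 1, hv.le, by positivity, ?_⟩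
        rw [add_comm]
        exact eq_X_add_C_of_natDegree_le_one h1.le
      · have hgnd : g.natDegree = B.natDegree := by
          rw [← natDegree_neg, hgR, natDegree_add_eq_right_of_natDegree_lt, natDegree_C_mul hc0]
          rw [natDegree_C_mul hc0]
          omega
        have h1 : (B / g).natDegree = 0 := by omega
        have hw : (B / g).coeff 0 ≠ 0 := by
          have : (B / g).coeff 0 = (B / g).leadingCoeff := by rw [leadingCoeff, h1]
          rw [this, hqlc]
          exact div_ne_zero hlB (leadingCoeff_ne_zero.2 hgne)
        refine ⟨(B / g).coeff 0, 0, le_rfl, by simpa using hw, ?_⟩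
        rw [C_0, zero_mul, add_zero]
        exact eq_C_of_natDegree_eq_zero h1
    obtain ⟨w, v, hv, hwv, hq⟩ := hquot
    refine ⟨l, w, v, M', t', hlpos, hv, hwv, h0', ht', by omega, ?_, ?_⟩
    · rw [← hR', ← hg', ← hq]; exact hdiv2
    · rw [← hg']; exact hAg

end KreinString

/-! ### Node lists and the spectral theory of a half line -/

namespace KreinString

open Polynomial

/-- Finite lists of nodes `(x, ω, v)`, from left to right. -/
structure IsNodeList (L : List (ℝ × ℝ × ℝ)) : Prop where
  sorted : L.Pairwise fun p q => p.1 < q.1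
  nonneg : ∀ p ∈ L, 0 ≤ p.2.2
  weight_pos : ∀ p ∈ L, 0 < |p.2.1| + p.2.2

theorem IsNodeList.tail {p : ℝ × ℝ × ℝ} {L : List (ℝ × ℝ × ℝ)} (h : IsNodeList (p :: L)) :
    IsNodeList L :=
  ⟨(List.pairwise_cons.1 h.sorted).2, fun q hq => h.nonneg q (List.mem_cons_of_mem _ hq),
    fun q hq => h.weight_pos q (List.mem_cons_of_mem _ hq)⟩

theorem IsNodeList.exp_lt {p : ℝ × ℝ × ℝ} {L : List (ℝ × ℝ × ℝ)} (h : IsNodeList (p :: L)) :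
    ∀ q ∈ L, Real.exp p.1 < Real.exp q.1 :=
  fun q hq => Real.exp_lt_exp.2 ((List.pairwise_cons.1 h.sorted).1 q hq)

/-- The weight of a node, divided by the spectral parameter. -/
noncomputable def weightPoly (p : ℝ × ℝ × ℝ) : ℝ[X] := C p.2.1 + C p.2.2 * X

/-- Left of the nodes the solution that equals `exp (-x / 2)` near `+∞` is
`X * b * exp (x / 2) + c * exp (-x / 2)` with `(b, c) = sol L`. -/
noncomputable def sol : List (ℝ × ℝ × ℝ) → ℝ[X] × ℝ[X]
  | [] => (0, 1)
  | p :: L =>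
    ((sol L).1 + C (Real.exp (-p.1)) * weightPoly p *
        ((sol L).2 + C (Real.exp p.1) * X * (sol L).1),
      (sol L).2 - X * weightPoly p * ((sol L).2 + C (Real.exp p.1) * X * (sol L).1))

/-- The value of the solution at `x`, for `s = exp x`, up to a factor `exp (-x / 2)`. -/
noncomputable def valuePoly (L : List (ℝ × ℝ × ℝ)) (s : ℝ) : ℝ[X] :=
  (sol L).2 + C s * X * (sol L).1

theorem sol_nil : sol [] = (0, 1) := rfl

theorem sol_cons (p : ℝ × ℝ × ℝ) (L : List (ℝ × ℝ × ℝ)) : sol (p :: L) =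
    ((sol L).1 + C (Real.exp (-p.1)) * weightPoly p * valuePoly L (Real.exp p.1),
      (sol L).2 - X * weightPoly p * valuePoly L (Real.exp p.1)) := rfl

theorem C_exp_mul_C_exp_neg (x : ℝ) : (C (Real.exp x) * C (Real.exp (-x)) : ℝ[X]) = 1 := by
  rw [← C_mul, ← Real.exp_add, add_neg_cancel, Real.exp_zero, C_1]

/-- Continuity at the node `p`: in the variable `s = exp x` the rescaled solution is affine on each
gap, with slope `X` times the first component of `sol`. Together with `sol_cons` this is the
continued fraction of `stieltjes_step` read backwards. -/
theorem valuePoly_cons (p : ℝ × ℝ × ℝ) (L : List (ℝ × ℝ × ℝ)) (s : ℝ) :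
    valuePoly (p :: L) s = valuePoly L (Real.exp p.1) -
      C (Real.exp p.1 - s) * X * (sol (p :: L)).1 := by
  have h := C_exp_mul_C_exp_neg p.1
  rw [valuePoly, sol_cons]
  have h2 : valuePoly L (Real.exp p.1) = (sol L).2 + C (Real.exp p.1) * X * (sol L).1 := rfl
  simp only [C_sub]
  linear_combination (X * weightPoly p * valuePoly L (Real.exp p.1)) * h - h2

theorem sol_snd_eq (L : List (ℝ × ℝ × ℝ)) (s : ℝ) :
    (sol L).2 = valuePoly L s - C s * X * (sol L).1 := by
  rw [valuePoly]; ring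

theorem eval_zero_valuePoly (L : List (ℝ × ℝ × ℝ)) (s : ℝ) : (valuePoly L s).eval 0 = 1 := by
  have h : (sol L).2.eval 0 = 1 := by
    induction L with
    | nil => simp [sol]
    | cons p L ih => simp [sol, ih]
  simp [valuePoly, h]

theorem valuePoly_ne_zero (L : List (ℝ × ℝ × ℝ)) (s : ℝ) : valuePoly L s ≠ 0 := by
  intro h
  have := eval_zero_valuePoly L s
  simp [h] at this

theorem weightPoly_ne_zero {p : ℝ × ℝ × ℝ} (hp : 0 < |p.2.1| + p.2.2) : weightPoly p ≠ 0 := by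
  intro h
  have h0 := congrArg (coeff · 0) h
  have h1 := congrArg (coeff · 1) h
  simp [weightPoly] at h0 h1
  simp [h0, h1] at hp

theorem degree_valuePoly_le {p : ℝ × ℝ × ℝ} {L : List (ℝ × ℝ × ℝ)} (hp : 0 < |p.2.1| + p.2.2)
    (hL : (sol L).1.degree < (valuePoly L (Real.exp p.1)).degree) :
    (valuePoly L (Real.exp p.1)).degree ≤ (sol (p :: L)).1.degree := by
  have h1 : C (Real.exp (-p.1)) * weightPoly p ≠ 0 :=
    mul_ne_zero (C_ne_zero.2 (Real.exp_ne_zero _)) (weightPoly_ne_zero hp)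
  have h2 : (valuePoly L (Real.exp p.1)).degree ≤
      (C (Real.exp (-p.1)) * weightPoly p * valuePoly L (Real.exp p.1)).degree :=
    degree_le_mul_left _ h1 |>.trans_eq (by rw [mul_comm])
  rw [sol_cons]
  simp only
  rwa [degree_add_eq_right_of_degree_lt (hL.trans_le h2)]

/-- Degrees alternate: a nonzero weight lifts the slope polynomial at least to the degree of the
value, and the next gap of positive length lifts the value one above the slope. -/
theorem degree_sol_lt {L : List (ℝ × ℝ × ℝ)} (hL : IsNodeList L) :
    ∀ {s : ℝ}, (∀ p ∈ L, s < Real.exp p.1) → (sol L).1.degree < (valuePoly L s).degree := by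
  induction L with
  | nil => intro s _; simp [sol, valuePoly]
  | cons p L ih =>
    intro s hs
    have h1 := degree_valuePoly_le (hL.weight_pos p List.mem_cons_self) (ih hL.tail hL.exp_lt)
    have hB : (sol (p :: L)).1 ≠ 0 := by
      intro h
      rw [h, degree_zero, le_bot_iff, degree_eq_bot] at h1
      exact valuePoly_ne_zero _ _ h1
    have hl : Real.exp p.1 - s ≠ 0 := (sub_pos.2 (hs p List.mem_cons_self)).ne'
    have h2 : (C (Real.exp p.1 - s) * X * (sol (p :: L)).1).degree =
        (sol (p :: L)).1.degree + 1 := by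
      rw [mul_assoc, degree_C_mul hl, mul_comm, degree_mul_X]
    have h3 : (sol (p :: L)).1.degree < (sol (p :: L)).1.degree + 1 := by
      rw [degree_eq_natDegree hB]
      exact_mod_cast Nat.lt_succ_self _
    rw [valuePoly_cons, degree_sub_eq_right_of_degree_lt] <;> rw [h2]
    · exact h3
    · exact h1.trans_lt h3

theorem isHerglotz_sol {L : List (ℝ × ℝ × ℝ)} (hL : IsNodeList L) :
    ∀ {s : ℝ}, L ≠ [] → (∀ p ∈ L, s < Real.exp p.1) → IsHerglotz (valuePoly L s) (sol L).1 := by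
  induction L with
  | nil => intro s h; exact absurd rfl h
  | cons p L ih =>
    intro s _ hs
    have hl : 0 < Real.exp p.1 - s := sub_pos.2 (hs p List.mem_cons_self)
    have he := Real.exp_pos (-p.1)
    have hv := hL.nonneg p List.mem_cons_self
    have hw := hL.weight_pos p List.mem_cons_self
    rw [valuePoly_cons]
    have hB : (sol (p :: L)).1 = (sol L).1 +
      C (Real.exp (-p.1)) * weightPoly p * valuePoly L (Real.exp p.1) := rfl
    set B := (sol (p :: L)).1
    set l := Real.exp p.1 - s
    set e := Real.exp (-p.1)
    -- Green's identity: the node contributes `v` times `|value|²` and the gap contributes its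
    -- length times `|slope|²`, both nonnegative. `hwr` is its counterpart on the real axis.
    have him : ∀ z : ℂ, (aeval z B * (starRingEnd ℂ)
        (aeval z (valuePoly L (Real.exp p.1) - C l * X * B))).im =
        (aeval z (sol L).1 * (starRingEnd ℂ) (aeval z (valuePoly L (Real.exp p.1)))).im +
        e * p.2.2 * z.im * Complex.normSq (aeval z (valuePoly L (Real.exp p.1))) +
        l * z.im * Complex.normSq (aeval z B) := by
      intro z
      have h1 : aeval z B * (starRingEnd ℂ) (aeval z (valuePoly L (Real.exp p.1) - C l * X * B)) =
          aeval z B * (starRingEnd ℂ) (aeval z (valuePoly L (Real.exp p.1))) -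
          ((l * Complex.normSq (aeval z B) : ℝ) : ℂ) * (starRingEnd ℂ) z := by
        rw [Complex.ofReal_mul, ← Complex.mul_conj]
        simp
        ring
      have h2 : aeval z B * (starRingEnd ℂ) (aeval z (valuePoly L (Real.exp p.1))) =
          aeval z (sol L).1 * (starRingEnd ℂ) (aeval z (valuePoly L (Real.exp p.1))) +
          ((e * Complex.normSq (aeval z (valuePoly L (Real.exp p.1))) : ℝ) : ℂ) *
            (p.2.1 + p.2.2 * z) := by
        rw [Complex.ofReal_mul, ← Complex.mul_conj, hB]
        simp [weightPoly]
        ring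
      rw [h1, Complex.sub_im, h2, Complex.add_im, Complex.im_ofReal_mul, Complex.im_ofReal_mul]
      simp
      ring
    have hwr : ∀ x : ℝ, (derivative B).eval x *
        (valuePoly L (Real.exp p.1) - C l * X * B).eval x - B.eval x *
        (derivative (valuePoly L (Real.exp p.1) - C l * X * B)).eval x =
        ((derivative (sol L).1).eval x * (valuePoly L (Real.exp p.1)).eval x -
          (sol L).1.eval x * (derivative (valuePoly L (Real.exp p.1))).eval x) +
        e * p.2.2 * (valuePoly L (Real.exp p.1)).eval x ^ 2 + l * B.eval x ^ 2 := by
      intro x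
      rw [hB]
      simp [weightPoly]
      ring
    -- Strictness originates at the right-most node, where the inherited term is zero. There the gap
    -- term is positive if the slope is nonzero; on the real axis the slope can vanish only when `v
    -- > 0`, and then the node term is positive.
    rcases eq_or_ne L [] with rfl | hne
    · have hg : valuePoly [] (Real.exp p.1) = 1 := by simp [valuePoly, sol]
      have hB1 : B = C e * weightPoly p := by rw [hB, hg]; simp [sol]
      refine ⟨fun z hz => ?_, fun x => ?_⟩
      · rw [him, hg, sol_nil]
        have hne : aeval z B ≠ 0 := by
          rw [hB1]
          simp only [weightPoly, map_mul, map_add, aeval_C, aeval_X, Complex.coe_algebraMap]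
          refine mul_ne_zero (by exact_mod_cast he.ne') fun h => ?_
          have h1 := congrArg Complex.im h
          have h2 := congrArg Complex.re h
          simp [hz.ne'] at h1
          simp [h1] at h2
          simp [h1, h2] at hw
        have h1 := mul_pos (mul_pos hl hz) (Complex.normSq_pos.2 hne)
        have h2 := mul_nonneg (mul_nonneg he.le hv) hz.le
        simp
        linarith
      · rw [hwr, hg, sol_nil]
        simp only [derivative_zero, eval_zero, eval_one, zero_mul, sub_zero, zero_add, one_pow,
          mul_one]
        rcases hv.eq_or_lt with h | h
        · have : B.eval x ≠ 0 := by
            rw [hB1]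
            simp [weightPoly, ← h, he.ne']
            simpa [← h] using hw
          have := mul_pos hl (sq_pos_iff.2 this)
          rw [← h]
          linarith
        · have := mul_pos he h
          have := mul_nonneg hl.le (sq_nonneg (B.eval x))
          linarith
    · have h := ih hL.tail hne hL.exp_lt
      refine ⟨fun z hz => ?_, fun x => ?_⟩
      · rw [him]
        have h1 := h.im_pos z hz
        have h2 := mul_nonneg (mul_nonneg (mul_nonneg he.le hv) hz.le)
          (Complex.normSq_nonneg (aeval z (valuePoly L (Real.exp p.1))))
        have h3 := mul_nonneg (mul_nonneg hl.le hz.le) (Complex.normSq_nonneg (aeval z B))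
        linarith
      · rw [hwr]
        have h1 := h.wronskian_pos x
        have h2 := mul_nonneg (mul_nonneg he.le hv)
          (sq_nonneg ((valuePoly L (Real.exp p.1)).eval x))
        have h3 := mul_nonneg hl.le (sq_nonneg (B.eval x))
        linarith

/-- The direct spectral theorem on a half line. -/
theorem exists_valuePoly_eq_rootPoly {L : List (ℝ × ℝ × ℝ)} (hL : IsNodeList L) {s : ℝ}
    (hs : ∀ p ∈ L, s < Real.exp p.1) :
    ∃ (M : Finset ℝ) (t : ℝ → ℝ), 0 ∉ M ∧ (∀ μ ∈ M, 0 < t μ) ∧ (∀ μ ∉ M, t μ = 0) ∧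
      valuePoly L s = rootPoly M ∧ (sol L).1 = residuePoly M t := by
  rcases eq_or_ne L [] with rfl | hne
  · exact ⟨∅, 0, by simp, by simp, by simp, by simp [valuePoly, sol], by simp [sol]⟩
  · exact (isHerglotz_sol hL hne hs).exists_remainder (eval_zero_valuePoly L s) (q := 0) (by simp)
      (degree_sol_lt hL hs)

/-- The inverse spectral theorem on a half line: existence. -/
theorem exists_nodeList (n : ℕ) : ∀ {M : Finset ℝ} {t : ℝ → ℝ} {s : ℝ}, M.card = n → 0 ∉ M →
    (∀ μ ∈ M, 0 < t μ) → 0 ≤ s → ∃ L, IsNodeList L ∧ (∀ p ∈ L, s < Real.exp p.1) ∧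
      valuePoly L s = rootPoly M ∧ (sol L).1 = residuePoly M t := by
  induction n using Nat.strong_induction_on with
  | _ n ih =>
    intro M t s hn h0 ht hs
    rcases M.eq_empty_or_nonempty with rfl | hM
    · exact ⟨[], ⟨by simp, by simp, by simp⟩, by simp, by simp [valuePoly, sol], by simp [sol]⟩
    obtain ⟨l, w, v, M', t', hl, hv, hwv, h0', ht', hcard, hB, hA⟩ := stieltjes_step h0 hM ht
    have hsl : 0 < s + l := by linarith
    obtain ⟨L, hL, hLs, hLA, hLB⟩ := ih _ (hn ▸ hcard) rfl h0' ht' hsl.le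
    have hexp : Real.exp (Real.log (s + l)) = s + l := Real.exp_log hsl
    -- A gap of length `l` in the variable `exp x` ends at `s + l`. The weights are scaled by `s +
    -- l` to compensate the factor `exp (-x)` in `sol`.
    set p : ℝ × ℝ × ℝ := (Real.log (s + l), (s + l) * w, (s + l) * v) with hp
    have hB' : (sol (p :: L)).1 = residuePoly M t := by
      rw [sol_cons, hB]
      simp only [hp, hexp, hLA, hLB]
      have h1 : (C (Real.exp (-Real.log (s + l))) * C (s + l) : ℝ[X]) = 1 := by
        rw [Real.exp_neg, hexp, ← C_mul, inv_mul_cancel₀ hsl.ne', C_1]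
      simp only [weightPoly, C_mul]
      linear_combination ((C w + C v * X) * rootPoly M') * h1
    refine ⟨p :: L, ⟨?_, ?_, ?_⟩, ?_, ?_, hB'⟩
    · refine List.pairwise_cons.2 ⟨fun q hq => ?_, hL.sorted⟩
      have := hLs q hq
      rwa [← hexp, Real.exp_lt_exp] at this
    · intro q hq
      rcases List.mem_cons.1 hq with rfl | hq
      · exact mul_nonneg hsl.le hv
      · exact hL.nonneg q hq
    · intro q hq
      rcases List.mem_cons.1 hq with rfl | hq
      · simp only [hp, abs_mul, abs_of_pos hsl]
        rw [← mul_add]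
        exact mul_pos hsl hwv
      · exact hL.weight_pos q hq
    · intro q hq
      rcases List.mem_cons.1 hq with rfl | hq
      · simp only [hp, hexp]
        linarith
      · have := hLs q hq
        linarith
    · rw [valuePoly_cons, hB', hA]
      simp only [hp, hexp, hLA, add_sub_cancel_left]

/-- The inverse spectral theorem: uniqueness. -/
theorem sol_injective {L : List (ℝ × ℝ × ℝ)} (hL : IsNodeList L) :
    ∀ {L' : List (ℝ × ℝ × ℝ)}, IsNodeList L' → sol L = sol L' → L = L' := by
  have hne : ∀ {p : ℝ × ℝ × ℝ} {L : List (ℝ × ℝ × ℝ)}, IsNodeList (p :: L) →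
      (sol (p :: L)).1 ≠ 0 := by
    intro p L h h1
    have h2 := degree_valuePoly_le (h.weight_pos p List.mem_cons_self) (degree_sol_lt h.tail h.exp_lt)
    rw [h1, degree_zero, le_bot_iff, degree_eq_bot] at h2
    exact valuePoly_ne_zero _ _ h2
  induction L with
  | nil =>
    intro L' hL' h
    cases L' with
    | nil => rfl
    | cons p L' => exact absurd (by rw [← h, sol_nil]) (hne hL')
  | cons p L ih =>
    intro L' hL' h
    cases L' with
    | nil => exact absurd (by rw [h, sol_nil]) (hne hL)
    | cons p' L' =>
      have hd := degree_sol_lt hL.tail hL.exp_lt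
      have hd' := degree_sol_lt hL'.tail hL'.exp_lt
      have hle := degree_valuePoly_le (hL.weight_pos p List.mem_cons_self) hd
      have hle' := degree_valuePoly_le (hL'.weight_pos p' List.mem_cons_self) hd'
      have hB := hne hL
      have hV := valuePoly_cons p L 0
      have hV' := valuePoly_cons p' L' 0
      have hVV : valuePoly (p :: L) 0 = valuePoly (p' :: L') 0 := by rw [valuePoly, valuePoly, h]
      rw [← h] at hle' hV'
      have hdiff : C (Real.exp p.1 - Real.exp p'.1) * (X * (sol (p :: L)).1) =
          valuePoly L (Real.exp p.1) - valuePoly L' (Real.exp p'.1) := by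
        simp only [C_sub, C_0] at hV hV' ⊢
        linear_combination hV - hV' - hVV
      -- Different positions would make the difference of the two node values one degree higher than
      -- the slope, while each of them has at most the degree of the slope.
      have hx : Real.exp p.1 = Real.exp p'.1 := by
        by_contra hne'
        have h1 := (degree_sub_le _ _).trans (max_le hle hle')
        rw [← hdiff, degree_C_mul (sub_ne_zero.2 hne'), mul_comm, degree_mul_X,
          degree_eq_natDegree hB] at h1
        norm_cast at h1
        omega
      have hg : valuePoly L (Real.exp p.1) = valuePoly L' (Real.exp p'.1) := by
        rw [sub_eq_zero.2 hx, C_0, zero_mul] at hdiff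
        exact sub_eq_zero.1 hdiff.symm
      have hx' : p.1 = p'.1 := Real.exp_injective hx
      have hB2 : (sol L).1 + C (Real.exp (-p.1)) * weightPoly p * valuePoly L (Real.exp p.1) =
          (sol L').1 + C (Real.exp (-p.1)) * weightPoly p' * valuePoly L (Real.exp p.1) := by
        have := congrArg Prod.fst h
        simp only [sol_cons] at this
        rwa [← hg, ← hx'] at this
      -- Uniqueness of division with remainder: the weight is the quotient of the slope by the node
      -- value, and the slope to the right of the node is the remainder.
      have hw : weightPoly p = weightPoly p' := by
        by_contra hne'
        have h1 : C (Real.exp (-p.1)) * (weightPoly p - weightPoly p') *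
            valuePoly L (Real.exp p.1) = (sol L').1 - (sol L).1 := by
          linear_combination hB2
        have h2 : ((sol L').1 - (sol L).1).degree < (valuePoly L (Real.exp p.1)).degree :=
          (degree_sub_le _ _).trans_lt (max_lt (hg ▸ hd') hd)
        rw [← h1, mul_comm] at h2
        exact absurd (degree_le_mul_left _ (mul_ne_zero (C_ne_zero.2 (Real.exp_ne_zero _))
          (sub_ne_zero.2 hne'))) (not_le.2 h2)
      have hp : p = p' := by
        have h0 := congrArg (coeff · 0) hw
        have h1 := congrArg (coeff · 1) hw
        simp [weightPoly] at h0 h1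
        exact Prod.ext hx' (Prod.ext h0 h1)
      have hs1 : (sol L).1 = (sol L').1 := by
        rw [hw] at hB2
        exact add_right_cancel hB2
      have hs2 : (sol L).2 = (sol L').2 := by
        rw [sol_snd_eq L (Real.exp p.1), sol_snd_eq L' (Real.exp p.1), hg, hx, hs1]
      rw [hp, ih hL.tail hL'.tail (Prod.ext hs1 hs2)]

end KreinString

/-! ### Solutions, norming constants and eigenvalues in terms of polynomials -/

namespace DiscretePair

open Polynomial KreinString

/-- The nodes with their weights, from left to right. -/
noncomputable def toList (H : DiscretePair) : List (ℝ × ℝ × ℝ) :=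
  List.ofFn fun i => (H.x i, H.ω i, H.v i)

theorem isNodeList_toList (H : DiscretePair) : IsNodeList H.toList := by
  refine ⟨?_, fun p hp => ?_, fun p hp => ?_⟩
  · rw [toList, List.pairwise_ofFn]
    exact fun i j hij => H.x_strictMono hij
  · obtain ⟨i, rfl⟩ := (List.mem_ofFn' _ _).1 hp
    exact H.v_nonneg i
  · obtain ⟨i, rfl⟩ := (List.mem_ofFn' _ _).1 hp
    exact H.weight_pos i

theorem toList_injective {H K : DiscretePair} (h : H.toList = K.toList) : H = K := by
  obtain ⟨n, x, w, v, h1, h2, h3⟩ := H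
  obtain ⟨n', x', w', v', h1', h2', h3'⟩ := K
  have hn : n = n' := by simpa [toList] using congrArg List.length h
  subst hn
  have h4 := congrFun (List.ofFn_injective h)
  simp only [Prod.mk.injEq] at h4
  congr 1
  · exact funext fun i => (h4 i).1
  · exact funext fun i => (h4 i).2.1
  · exact funext fun i => (h4 i).2.2

theorem exists_toList_eq {L : List (ℝ × ℝ × ℝ)} (hL : IsNodeList L) :
    ∃ H : DiscretePair, H.toList = L :=
  ⟨⟨L.length, fun i => (L.get i).1, fun i => (L.get i).2.1, fun i => (L.get i).2.2,
    fun i j hij => List.pairwise_iff_get.1 hL.sorted i j hij,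
    fun i => hL.nonneg _ (L.get_mem i), fun i => hL.weight_pos _ (L.get_mem i)⟩,
    List.ofFn_get L⟩

theorem phiPlus_spec (H : DiscretePair) (z : ℂ) : H.IsPhiPlus z (H.phiPlus z) :=
  (H.existsUnique_phiPlus z).choose_spec.1

theorem phiPlus_eq_phiAux (H : DiscretePair) (z : ℂ) : H.phiPlus z = H.phiAux z :=
  (H.existsUnique_phiPlus z).unique (H.phiPlus_spec z) (H.isPhiPlus_phiAux z)

theorem phiPlus_eq_sum (H : DiscretePair) (z : ℂ) (y : ℝ) :
    H.phiPlus z y = Complex.exp (-(y : ℂ) / 2) - 2 * (H.toList.map fun p =>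
      (z * p.2.1 + z ^ 2 * p.2.2) * H.phiPlus z p.1 * ramp p.1 y).sum := by
  rw [toList, List.map_ofFn, List.sum_ofFn, phiPlus_eq_phiAux]
  conv_lhs => rw [phiAux]
  simp only [coef_eq, Function.comp]

/-- Only nodes to the right of `y` act on `φ₊` at `y`, since the ramps of the others vanish; writing
`sinh` through exponentials turns the ramp sum into the recursion of `sol`. -/
theorem phiPlus_of_append (H : DiscretePair) (z : ℂ) {L : List (ℝ × ℝ × ℝ)} :
    ∀ {L₁ : List (ℝ × ℝ × ℝ)}, H.toList = L₁ ++ L → ∀ {y : ℝ}, (∀ p ∈ L₁, p.1 ≤ y) →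
      (∀ p ∈ L, y ≤ p.1) →
      H.phiPlus z y = (Real.exp (-y / 2) : ℝ) * aeval z (valuePoly L (Real.exp y)) := by
  -- The sum is truncated to the suffix and no condition relates `y` to the prefix, so in the
  -- induction the formula for a shorter suffix also holds at points left of the node just added.
  have key : ∀ {L₁ : List (ℝ × ℝ × ℝ)}, H.toList = L₁ ++ L → ∀ {y : ℝ}, (∀ p ∈ L, y ≤ p.1) →
      Complex.exp (-(y : ℂ) / 2) - 2 * (L.map fun p =>
        (z * p.2.1 + z ^ 2 * p.2.2) * H.phiPlus z p.1 * ramp p.1 y).sum =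
      (Real.exp (-y / 2) : ℝ) * aeval z (valuePoly L (Real.exp y)) := by
    induction L with
    | nil =>
      intro L₁ _ y _
      simp [valuePoly, sol]
    | cons p L ih =>
      intro L₁ hL y hy
      have hnl : IsNodeList H.toList := H.isNodeList_toList
      have hL' : H.toList = (L₁ ++ [p]) ++ L := by simp [hL]
      have hs := hnl.sorted
      rw [hL, List.pairwise_append] at hs
      have hpy : y ≤ p.1 := hy p List.mem_cons_self
      have hval : H.phiPlus z p.1 =
          (Real.exp (-p.1 / 2) : ℝ) * aeval z (valuePoly L (Real.exp p.1)) := by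
        rw [← ih hL' fun q hq => ((List.pairwise_cons.1 hs.2.1).1 q hq).le, phiPlus_eq_sum, hL']
        rw [List.map_append, List.sum_append]
        have : ((L₁ ++ [p]).map fun q => (z * q.2.1 + z ^ 2 * q.2.2) * H.phiPlus z q.1 *
            ramp q.1 p.1).sum = 0 := by
          refine List.sum_eq_zero fun c hc => ?_
          obtain ⟨q, hq, rfl⟩ := List.mem_map.1 hc
          rw [ramp_of_ge, mul_zero]
          rcases List.mem_append.1 hq with hq | hq
          · exact (hs.2.2 q hq p List.mem_cons_self).le
          · rw [List.mem_singleton.1 hq]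
        rw [this, zero_add]
      have hih := ih hL' fun q hq => hy q (List.mem_cons_of_mem _ hq)
      have hcons : valuePoly (p :: L) (Real.exp y) = valuePoly L (Real.exp y) +
          (C (Real.exp y) * C (Real.exp (-p.1)) - 1) * (X * weightPoly p *
            valuePoly L (Real.exp p.1)) := by
        simp only [valuePoly, sol]
        ring
      rw [List.map_cons, List.sum_cons, hcons, map_add, mul_add _ (aeval z _), ← hih, hval, ramp_of_le hpy,
        Real.sinh_eq]
      have e1 : Real.exp (-p.1 / 2) * Real.exp ((p.1 - y) / 2) = Real.exp (-y / 2) := by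
        rw [← Real.exp_add]; congr 1; ring
      have e2 : Real.exp (-p.1 / 2) * Real.exp (-((p.1 - y) / 2)) =
          Real.exp (-y / 2) * (Real.exp y * Real.exp (-p.1)) := by
        rw [← Real.exp_add, ← Real.exp_add, ← Real.exp_add]; congr 1; ring
      have e1' := congrArg (Complex.ofReal) e1
      have e2' := congrArg (Complex.ofReal) e2
      simp only [weightPoly, map_mul, map_sub, map_add, map_one, aeval_C, aeval_X,
        Complex.coe_algebraMap, Complex.ofReal_mul, Complex.ofReal_div, Complex.ofReal_sub,
        Complex.ofReal_ofNat] at e1' e2' ⊢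
      linear_combination (-(z * p.2.1 + z ^ 2 * p.2.2) *
        aeval z (valuePoly L (Real.exp p.1))) * (e1' - e2')
  intro L₁ hL y h1 h2
  rw [← key hL h2, phiPlus_eq_sum, hL, List.map_append, List.sum_append]
  have : (L₁.map fun q => (z * q.2.1 + z ^ 2 * q.2.2) * H.phiPlus z q.1 * ramp q.1 y).sum = 0 := by
    refine List.sum_eq_zero fun c hc => ?_
    obtain ⟨q, hq, rfl⟩ := List.mem_map.1 hc
    rw [ramp_of_ge (h1 q hq), mul_zero]
  rw [this, zero_add]

theorem gammaSq_eq_sum (H : DiscretePair) (μ : ℝ) :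
    H.gammaSq μ =
      (H.toList.map fun p => ‖H.phiPlus μ p.1‖ ^ 2 * (p.2.1 + 2 * μ * p.2.2)).sum := by
  rw [toList, List.map_ofFn, List.sum_ofFn, gammaSq, Finset.mul_sum, ← Finset.sum_add_distrib]
  refine Finset.sum_congr rfl fun i _ => ?_
  simp only [Function.comp]
  ring

/-- Lagrange's identity in the spectral parameter: the Wronskian of the two coefficients of `φ₊` is
unchanged along gaps, and at a node it grows by `φ₊²` times the `z`-derivative of `z ω + z² v`. -/
theorem gammaSq_eq (H : DiscretePair) (μ : ℝ) :
    H.gammaSq μ = ((sol H.toList).2 * derivative (X * (sol H.toList).1) -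
      X * (sol H.toList).1 * derivative (sol H.toList).2).eval μ := by
  have key : ∀ L L₁ : List (ℝ × ℝ × ℝ), H.toList = L₁ ++ L →
      (L.map fun p => ‖H.phiPlus μ p.1‖ ^ 2 * (p.2.1 + 2 * μ * p.2.2)).sum =
      ((sol L).2 * derivative (X * (sol L).1) - X * (sol L).1 * derivative (sol L).2).eval μ := by
    intro L
    induction L with
    | nil => simp [sol]
    | cons p L ih =>
      intro L₁ hL
      have hL' : H.toList = (L₁ ++ [p]) ++ L := by simp [hL]
      have hs := H.isNodeList_toList.sorted
      rw [hL, List.pairwise_append] at hs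
      have hval : H.phiPlus μ p.1 =
          (Real.exp (-p.1 / 2) : ℝ) * aeval (μ : ℂ) (valuePoly L (Real.exp p.1)) := by
        refine H.phiPlus_of_append μ hL' (fun q hq => ?_)
          fun q hq => ((List.pairwise_cons.1 hs.2.1).1 q hq).le
        rcases List.mem_append.1 hq with hq | hq
        · exact (hs.2.2 q hq p List.mem_cons_self).le
        · rw [List.mem_singleton.1 hq]
      have hreal : aeval (μ : ℂ) (valuePoly L (Real.exp p.1)) =
          (((valuePoly L (Real.exp p.1)).eval μ : ℝ) : ℂ) := by
        rw [← coe_aeval_eq_eval]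
        exact aeval_algebraMap_apply ℂ μ _
      rw [hreal, ← Complex.ofReal_mul] at hval
      have hsq : Real.exp (-p.1 / 2) ^ 2 = Real.exp (-p.1) := by
        rw [← Real.exp_nat_mul]; congr 1; push_cast; ring
      have hE : Real.exp p.1 * Real.exp (-p.1) = 1 := by
        rw [← Real.exp_add, add_neg_cancel, Real.exp_zero]
      rw [List.map_cons, List.sum_cons, ih _ hL', hval, Complex.norm_real, Real.norm_eq_abs,
        sq_abs, mul_pow, hsq]
      simp only [valuePoly, sol, weightPoly, eval_add, eval_sub, eval_mul, eval_C, eval_X,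
        derivative_add, derivative_sub, derivative_mul, derivative_C, derivative_X, eval_zero,
        eval_one]
      generalize Real.exp p.1 = e at hE ⊢
      generalize Real.exp (-p.1) = e' at hE ⊢
      obtain rfl : e' = e⁻¹ := (inv_eq_of_mul_eq_one_right hE).symm
      have he : e ≠ 0 := left_ne_zero_of_mul_eq_one hE
      field_simp
      ring
  rw [gammaSq_eq_sum]
  exact key _ [] rfl

theorem exists_le_nodes (H : DiscretePair) : ∃ b : ℝ, ∀ p ∈ H.toList, b ≤ p.1 := by
  obtain ⟨b, hb⟩ := (H.toList.map Prod.fst).toFinset.bddBelow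
  exact ⟨b, fun p hp => hb (by simpa using ⟨p.2.1, p.2.2, hp⟩)⟩

theorem IsSolution.const_mul {H : DiscretePair} {z : ℂ} {f : ℝ → ℂ} (hf : H.IsSolution z f)
    (c : ℂ) : H.IsSolution z (fun y => c * f y) := by
  have hd : deriv (fun y => c * f y) = fun y => c * deriv f y :=
    funext fun y => deriv_const_mul_field c
  refine ⟨continuous_const.mul hf.1, fun y hy => ⟨(hf.2.1 y hy).1.const_mul c, ?_⟩, fun i => ?_⟩
  · rw [hd, mul_div_assoc]
    exact (hf.2.1 y hy).2.const_mul c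
  · obtain ⟨p, q, h1, h2, h3⟩ := hf.2.2 i
    rw [hd]
    exact ⟨c * p, c * q, h1.const_mul c, h2.const_mul c, by rw [h3]; ring⟩

theorem eq_zero_of_mul_exp_le {c K b : ℝ} (hc : 0 ≤ c)
    (h : ∀ y, b ≤ y → c * Real.exp (y / 2) ≤ K) : c = 0 := by
  by_contra hne
  have h1 : Tendsto (fun y : ℝ => c * Real.exp (y / 2)) atTop atTop :=
    (Real.tendsto_exp_atTop.comp (tendsto_id.atTop_div_const two_pos)).const_mul_atTop
      (lt_of_le_of_ne hc (Ne.symm hne))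
  obtain ⟨y, hy1, hy2⟩ := ((h1.eventually_gt_atTop K).and (eventually_ge_atTop b)).exists
  exact absurd (h y hy2) (not_le.2 hy1)

/-- A solution that is bounded near `+∞` is a multiple of `φ₊`. -/
theorem IsSolution.eq_mul_phiPlus {H : DiscretePair} {z : ℂ} {f : ℝ → ℂ} (hf : H.IsSolution z f)
    {K : ℝ} (hK : ∀ y, ‖f y‖ ≤ K) : ∃ c : ℂ, ∀ y, f y = c * H.phiPlus z y := by
  obtain ⟨b, hb⟩ := (Set.finite_range H.x).bddAbove
  have hnode : ∀ y ∈ Set.Ioi b, y ∉ Set.range H.x := fun y hy h => not_le.2 hy (hb h)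
  -- First integrals of `f'' = f / 4`: `σ = 1 / 2` isolates the coefficient of the growing
  -- exponential, which boundedness kills, and `σ = -1 / 2` that of the decaying one.
  have key : ∀ σ : ℂ, σ ^ 2 = 1 / 4 → ∃ c : ℂ, ∀ y ∈ Set.Ioi b,
      (deriv f y + σ * f y) * Complex.exp (-σ * (y : ℂ)) = c := by
    intro σ hσ
    have hconst : ∀ r ∈ Set.Ioi b,
        HasDerivAt (fun r : ℝ => (deriv f r + σ * f r) * Complex.exp (-σ * (r : ℂ))) 0 r := by
      intro r hr
      have h1 := (hf.2.1 r (hnode r hr)).2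
      have h2 := (hf.2.1 r (hnode r hr)).1.hasDerivAt
      have h3 : HasDerivAt (fun r : ℝ => Complex.exp (-σ * (r : ℂ)))
          (Complex.exp (-σ * (r : ℂ)) * (-σ * 1)) r :=
        (((hasDerivAt_id r).ofReal_comp).const_mul (-σ)).cexp
      refine ((h1.add (h2.const_mul σ)).mul h3).congr_deriv ?_
      simp only [Pi.add_apply]
      linear_combination -(f r * Complex.exp (-σ * (r : ℂ))) * hσ
    refine ⟨(deriv f (b + 1) + σ * f (b + 1)) * Complex.exp (-σ * ((b + 1 : ℝ) : ℂ)),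
      fun y hy => ?_⟩
    exact isOpen_Ioi.is_const_of_deriv_eq_zero isPreconnected_Ioi
      (fun r hr => (hconst r hr).differentiableAt.differentiableWithinAt)
      (fun r hr => (hconst r hr).deriv) hy (by simp)
  obtain ⟨c₁, h1⟩ := key (1 / 2) (by norm_num)
  obtain ⟨c₂, h2⟩ := key (-1 / 2) (by norm_num)
  have hform : ∀ y ∈ Set.Ioi b, f y = c₁ * Complex.exp ((y : ℂ) / 2) -
      c₂ * Complex.exp (-(y : ℂ) / 2) := by
    intro y hy
    have e : Complex.exp ((y : ℂ) / 2) * Complex.exp (-(y : ℂ) / 2) = 1 := by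
      rw [← Complex.exp_add]; simp [neg_div]
    have h1' := h1 y hy
    have h2' := h2 y hy
    rw [show -(1 / 2 : ℂ) * (y : ℂ) = -(y : ℂ) / 2 by ring] at h1'
    rw [show -(-1 / 2 : ℂ) * (y : ℂ) = (y : ℂ) / 2 by ring] at h2'
    rw [← h1', ← h2']
    linear_combination (-f y) * e
  have hc1 : c₁ = 0 := by
    rw [← norm_eq_zero]
    refine eq_zero_of_mul_exp_le (b := max b 0 + 1) (K := K + ‖c₂‖) (norm_nonneg _) fun y hy => ?_
    have hyb : b < y := by have := le_max_left b 0; linarith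
    have hy0 : 0 ≤ y := by have := le_max_right b 0; linarith
    have h3 : c₁ * Complex.exp ((y : ℂ) / 2) = f y + c₂ * Complex.exp (-(y : ℂ) / 2) := by
      rw [hform y hyb]; ring
    have h4 : ‖Complex.exp ((y : ℂ) / 2)‖ = Real.exp (y / 2) := by
      rw [Complex.norm_exp]; simp
    have h5 : ‖Complex.exp (-(y : ℂ) / 2)‖ ≤ 1 := by
      rw [Complex.norm_exp, Real.exp_le_one_iff]
      simp
      linarith
    rw [← h4, ← norm_mul, h3]
    refine (norm_add_le _ _).trans (add_le_add (hK y) ?_)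
    rw [norm_mul]
    exact mul_le_of_le_one_right (norm_nonneg _) h5
  refine ⟨-c₂, fun y => sub_eq_zero.1 ?_⟩
  refine (hf.sub ((H.phiPlus_spec z).1.const_mul (-c₂))).eq_zero ?_ y
  filter_upwards [(H.phiPlus_spec z).2, eventually_gt_atTop b] with t h3 h4
  rw [h3, hform t h4, hc1]
  ring

/-- Boundedness at `+∞` leaves only multiples of `φ₊`, and the second component of `sol` is the
coefficient in `φ₊` of the exponential that grows at `-∞`. -/
theorem mem_spectrum_iff (H : DiscretePair) (z : ℂ) :
    z ∈ H.spectrum ↔ aeval z (sol H.toList).2 = 0 := by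
  obtain ⟨b, hb⟩ := H.exists_le_nodes
  have hleft : ∀ y ≤ b, H.phiPlus z y = (Real.exp (-y / 2) : ℝ) * aeval z (sol H.toList).2 +
      (Real.exp (y / 2) : ℝ) * (z * aeval z (sol H.toList).1) := by
    intro y hy
    rw [H.phiPlus_of_append z (L := H.toList) (L₁ := []) rfl (by simp) fun p hp => hy.trans (hb p hp)]
    have e : Real.exp (-y / 2) * Real.exp y = Real.exp (y / 2) := by
      rw [← Real.exp_add]; congr 1; ring
    rw [← e, valuePoly]
    simp only [map_add, map_mul, aeval_C, aeval_X, Complex.coe_algebraMap, Complex.ofReal_mul]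
    ring
  constructor
  · rintro ⟨f, hf, hne, K, hK⟩
    obtain ⟨c, hc⟩ := hf.eq_mul_phiPlus hK
    have hc0 : c ≠ 0 := by
      rintro rfl
      exact hne (funext fun y => by simp [hc y])
    rw [← norm_eq_zero]
    refine eq_zero_of_mul_exp_le (b := |b|)
      (K := K / ‖c‖ + ‖z * aeval z (sol H.toList).1‖) (norm_nonneg _) fun y hy => ?_
    have hyb : -y ≤ b := by have := neg_abs_le b; linarith
    have hy0 : -y ≤ 0 := by have := abs_nonneg b; linarith
    have h1 : (Real.exp (-(-y) / 2) : ℝ) * aeval z (sol H.toList).2 = H.phiPlus z (-y) -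
      (Real.exp (-y / 2) : ℝ) * (z * aeval z (sol H.toList).1) := by
      rw [hleft _ hyb]; ring
    have h2 := congrArg norm h1
    rw [norm_mul, Complex.norm_real, Real.norm_of_nonneg (Real.exp_pos _).le, neg_neg, mul_comm]
      at h2
    rw [h2]
    refine (norm_sub_le _ _).trans (add_le_add ?_ ?_)
    · rw [le_div_iff₀ (norm_pos_iff.2 hc0), mul_comm, ← norm_mul, ← hc]
      exact hK _
    · rw [norm_mul, Complex.norm_real, Real.norm_of_nonneg (Real.exp_pos _).le]
      refine mul_le_of_le_one_left (norm_nonneg _) (Real.exp_le_one_iff.2 (by linarith))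
  · intro h
    obtain ⟨b', hb'⟩ := eventually_atTop.1 (H.phiPlus_spec z).2
    refine ⟨H.phiPlus z, (H.phiPlus_spec z).1, fun h0 => ?_, ?_⟩
    · have := hb' b' le_rfl
      rw [h0] at this
      exact Complex.exp_ne_zero _ this.symm
    · obtain ⟨K, hK⟩ := (isCompact_Icc (a := b) (b := b')).exists_bound_of_continuousOn
        (H.phiPlus_spec z).1.1.continuousOn
      refine ⟨max K (max (Real.exp (b / 2) * ‖z * aeval z (sol H.toList).1‖)
        (Real.exp (-b' / 2))), fun y => ?_⟩
      rcases le_total y b with hy | hy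
      · refine le_max_of_le_right (le_max_of_le_left ?_)
        rw [hleft y hy, h, mul_zero, zero_add, norm_mul, Complex.norm_real,
          Real.norm_of_nonneg (Real.exp_pos _).le]
        gcongr
      rcases le_total y b' with hy' | hy'
      · exact le_max_of_le_left (hK y ⟨hy, hy'⟩)
      · refine le_max_of_le_right (le_max_of_le_right ?_)
        rw [hb' y hy', Complex.norm_exp, Real.exp_le_exp]
        simp
        linarith

end DiscretePair

/-! ### Reflection and transfer across a group of nodes -/

namespace KreinString

open Polynomial

/-- The image of a node list under `x ↦ -x`. -/
def reflect (L : List (ℝ × ℝ × ℝ)) : List (ℝ × ℝ × ℝ) := (L.map fun p => (-p.1, p.2)).reverse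

theorem reflect_append_singleton (L : List (ℝ × ℝ × ℝ)) (p : ℝ × ℝ × ℝ) :
    reflect (L ++ [p]) = (-p.1, p.2) :: reflect L := by
  simp [reflect]

theorem reflect_reflect (L : List (ℝ × ℝ × ℝ)) : reflect (reflect L) = L := by
  simp [reflect, Function.comp_def]

theorem mem_reflect {L : List (ℝ × ℝ × ℝ)} {p : ℝ × ℝ × ℝ} :
    p ∈ reflect L ↔ (-p.1, p.2) ∈ L := by
  simp only [reflect, List.mem_reverse, List.mem_map]
  constructor
  · rintro ⟨q, hq, rfl⟩
    simpa using hq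
  · exact fun h => ⟨_, h, by simp⟩

theorem IsNodeList.reflect {L : List (ℝ × ℝ × ℝ)} (hL : IsNodeList L) :
    IsNodeList (reflect L) := by
  refine ⟨?_, fun p hp => hL.nonneg (-p.1, p.2) (mem_reflect.1 hp),
    fun p hp => hL.weight_pos (-p.1, p.2) (mem_reflect.1 hp)⟩
  rw [KreinString.reflect, List.pairwise_reverse, List.pairwise_map]
  exact hL.sorted.imp fun h => neg_lt_neg h

theorem IsNodeList.of_append {L₁ L₂ : List (ℝ × ℝ × ℝ)} (h : IsNodeList (L₁ ++ L₂)) :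
    IsNodeList L₁ ∧ IsNodeList L₂ := by
  have hs := List.pairwise_append.1 h.sorted
  exact ⟨⟨hs.1, fun p hp => h.nonneg p (List.mem_append_left _ hp),
      fun p hp => h.weight_pos p (List.mem_append_left _ hp)⟩,
    ⟨hs.2.1, fun p hp => h.nonneg p (List.mem_append_right _ hp),
      fun p hp => h.weight_pos p (List.mem_append_right _ hp)⟩⟩

theorem IsNodeList.append {L₁ L₂ : List (ℝ × ℝ × ℝ)} (h₁ : IsNodeList L₁) (h₂ : IsNodeList L₂)
    (h : ∀ p ∈ L₁, ∀ q ∈ L₂, p.1 < q.1) : IsNodeList (L₁ ++ L₂) := by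
  refine ⟨List.pairwise_append.2 ⟨h₁.sorted, h₂.sorted, h⟩, fun p hp => ?_, fun p hp => ?_⟩
  · exact (List.mem_append.1 hp).elim (h₁.nonneg p) (h₂.nonneg p)
  · exact (List.mem_append.1 hp).elim (h₁.weight_pos p) (h₂.weight_pos p)

/-- The right side is the Wronskian of the solutions decaying at `+∞` and at `-∞`, taken between the
two groups of nodes. Moving a node from one group to the other does not change it. -/
theorem sol_append_snd (L₁ : List (ℝ × ℝ × ℝ)) : ∀ L₂, (sol (L₁ ++ L₂)).2 =
    (sol (reflect L₁)).2 * (sol L₂).2 - X * (sol (reflect L₁)).1 * (X * (sol L₂).1) := by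
  induction L₁ using List.reverseRecOn with
  | nil => intro L₂; simp [reflect, sol]
  | append_singleton L₁ p ih =>
    intro L₂
    rw [List.append_assoc, List.singleton_append, ih, reflect_append_singleton]
    simp only [sol, weightPoly, neg_neg]
    ring

/-- `T` and `S` form the first row of the transfer matrix across `L₁`, whose second row is the one
in `sol_append_snd`; the last identity says that its determinant is one. -/
theorem exists_transfer (L₁ : List (ℝ × ℝ × ℝ)) : ∃ T S : ℝ[X],
    (∀ L₂, X * (sol (L₁ ++ L₂)).1 = T * (X * (sol L₂).1) + S * (sol L₂).2) ∧
    T * (sol (reflect L₁)).2 + S * (X * (sol (reflect L₁)).1) = 1 := by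
  induction L₁ using List.reverseRecOn with
  | nil => exact ⟨1, 0, by simp, by simp [reflect, sol]⟩
  | append_singleton L₁ p ih =>
    obtain ⟨T, S, h1, h2⟩ := ih
    have hE := C_exp_mul_C_exp_neg p.1
    refine ⟨T * (1 + X * weightPoly p) - S * (X * weightPoly p * C (Real.exp p.1)),
      T * (X * weightPoly p * C (Real.exp (-p.1))) + S * (1 - X * weightPoly p), ?_, ?_⟩
    · intro L₂
      rw [List.append_assoc, List.singleton_append, h1]
      simp only [sol, weightPoly]
      generalize (C (Real.exp p.1) : ℝ[X]) = e at hE ⊢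
      generalize (C (Real.exp (-p.1)) : ℝ[X]) = e' at hE ⊢
      linear_combination (T * (X ^ 2 * (sol L₂).1 * (C p.2.1 + C p.2.2 * X))) * hE
    · rw [reflect_append_singleton]
      simp only [sol, weightPoly, neg_neg] at h2 ⊢
      generalize (C (Real.exp p.1) : ℝ[X]) = e at hE ⊢
      generalize (C (Real.exp (-p.1)) : ℝ[X]) = e' at hE ⊢
      linear_combination h2 + (T * (X * (C p.2.1 + C p.2.2 * X)) ^ 2 *
          ((sol (reflect L₁)).2 + e' * X * (sol (reflect L₁)).1) +
        S * (X * (C p.2.1 + C p.2.2 * X)) * (X * (sol (reflect L₁)).1)) * hE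

end KreinString

/-! ### Cutting the line at `a` -/

namespace DiscretePair

open Polynomial KreinString

/-- The poles and residues of the Weyl functions of the two half lines at `a`, and the weights of
the node `a`. -/
structure IsSplitting (H : DiscretePair) (a : ℝ) (MR ML : Finset ℝ) (tR tL : ℝ → ℝ) (w v : ℝ) :
    Prop where
  right_zero : 0 ∉ MR
  left_zero : 0 ∉ ML
  right_pos : ∀ μ ∈ MR, 0 < tR μ
  left_pos : ∀ μ ∈ ML, 0 < tL μ
  right_off : ∀ μ ∉ MR, tR μ = 0
  left_off : ∀ μ ∉ ML, tL μ = 0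
  charPoly_eq : (sol H.toList).2 = rootPoly MR * rootPoly ML - X * (residuePoly MR tR * rootPoly ML +
    residuePoly ML tL * rootPoly MR + (C w + C v * X) * (rootPoly MR * rootPoly ML))
  phiPlus_eq : ∀ z, H.phiPlus z a = (Real.exp (-a / 2) : ℝ) * aeval z (rootPoly MR)
  ratio : ∀ x, (sol H.toList).2.eval x = 0 → (rootPoly MR).eval x =
    Real.exp a * (x * (sol H.toList).1.eval x) * (rootPoly ML).eval x
  residue_ratio : ∀ x, (sol H.toList).2.eval x = 0 → (rootPoly MR).eval x = 0 →
    (residuePoly MR tR).eval x =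
      -(Real.exp a * (x * (sol H.toList).1.eval x) * (residuePoly ML tL).eval x)

/-- At an eigenvalue the solutions from the two ends are proportional; `ratio` compares their values
at `a`, and `residue_ratio` their slopes when both vanish there. The list `N` is compared with a
node at `a` only through `sol`, because a node of zero weight is not admissible and then `N` is
empty. -/
theorem isSplitting_of_toList {H : DiscretePair} {a : ℝ} {LL N LR : List (ℝ × ℝ × ℝ)} {w v : ℝ}
    (hH : H.toList = reflect LL ++ (N ++ LR)) (hN : ∀ p ∈ N, p.1 = a)
    (hNs : sol (N ++ LR) = sol ((a, w, v) :: LR))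
    (hLL : ∀ p ∈ LL, Real.exp (-a) < Real.exp p.1) (hLR : ∀ p ∈ LR, Real.exp a < Real.exp p.1)
    {MR ML : Finset ℝ} {tR tL : ℝ → ℝ} (hR0 : 0 ∉ MR) (hL0 : 0 ∉ ML)
    (hR : ∀ μ ∈ MR, 0 < tR μ) (hL : ∀ μ ∈ ML, 0 < tL μ)
    (hR' : ∀ μ ∉ MR, tR μ = 0) (hL' : ∀ μ ∉ ML, tL μ = 0)
    (hAR : valuePoly LR (Real.exp a) = rootPoly MR) (hBR : (sol LR).1 = residuePoly MR tR)
    (hAL : valuePoly LL (Real.exp (-a)) = rootPoly ML) (hBL : (sol LL).1 = residuePoly ML tL) :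
    H.IsSplitting a MR ML (fun μ => Real.exp a * tR μ) (fun μ => Real.exp (-a) * tL μ) w v := by
  have hE := C_exp_mul_C_exp_neg a
  have hexp : Real.exp a * Real.exp (-a) = 1 := by
    rw [← Real.exp_add, add_neg_cancel, Real.exp_zero]
  have hVR := sol_snd_eq LR (Real.exp a)
  have hVL := sol_snd_eq LL (Real.exp (-a))
  rw [hAR, hBR] at hVR
  rw [hAL, hBL] at hVL
  have hW := sol_append_snd (reflect LL) (N ++ LR)
  obtain ⟨T, S, hTS, hdet⟩ := exists_transfer (reflect LL)
  have hU := hTS (N ++ LR)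
  rw [reflect_reflect] at hW hdet
  rw [← hH, hNs, sol_cons, hAR, hBR] at hW hU
  rw [hBL] at hW hdet
  simp only [weightPoly] at hW hU
  -- One entry of the transferred vector vanishes at an eigenvalue, and determinant one allows
  -- solving for the vector at `a`.
  have hroot : ∀ x, (sol H.toList).2.eval x = 0 →
      x * ((residuePoly MR tR).eval x + Real.exp (-a) * (w + v * x) * (rootPoly MR).eval x) =
        x * (sol H.toList).1.eval x * (sol LL).2.eval x ∧
      (sol LR).2.eval x - x * (w + v * x) * (rootPoly MR).eval x =
        x * (sol H.toList).1.eval x * (x * (residuePoly ML tL).eval x) := by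
    intro x hx
    have h1 := congrArg (eval x) hW
    have h2 := congrArg (eval x) hU
    have h3 := congrArg (eval x) hdet
    rw [hx] at h1
    simp only [eval_add, eval_sub, eval_mul, eval_C, eval_X, eval_one] at h1 h2 h3
    constructor
    · linear_combination (-(x * ((residuePoly MR tR).eval x + Real.exp (-a) * (w + v * x) *
        (rootPoly MR).eval x))) * h3 - (sol LL).2.eval x * h2 + S.eval x * h1
    · linear_combination (-((sol LR).2.eval x - x * (w + v * x) *
        (rootPoly MR).eval x)) * h3 - (x * (residuePoly ML tL).eval x) * h2 - T.eval x * h1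
  have hratio : ∀ x, (sol H.toList).2.eval x = 0 → (rootPoly MR).eval x =
      Real.exp a * (x * (sol H.toList).1.eval x) * (rootPoly ML).eval x := by
    intro x hx
    obtain ⟨h1, h2⟩ := hroot x hx
    have h3 := congrArg (eval x) hVR
    have h4 := congrArg (eval x) hVL
    simp only [eval_sub, eval_mul, eval_C, eval_X] at h3 h4
    linear_combination Real.exp a * h1 + h2 - h3 +
      (Real.exp a * (x * (sol H.toList).1.eval x)) * h4 - ((rootPoly MR).eval x * x * (w + v * x) +
        x ^ 2 * (sol H.toList).1.eval x * (residuePoly ML tL).eval x) * hexp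
  refine ⟨hR0, hL0, fun μ hμ => mul_pos (Real.exp_pos _) (hR μ hμ),
    fun μ hμ => mul_pos (Real.exp_pos _) (hL μ hμ), fun μ hμ => by rw [hR' μ hμ, mul_zero],
    fun μ hμ => by rw [hL' μ hμ, mul_zero], ?_, fun z => ?_, fun x hx => ?_, fun x hx hx0 => ?_⟩
  · rw [hW, hVR, hVL, residuePoly_smul, residuePoly_smul]
    linear_combination (X ^ 2 * residuePoly ML tL * residuePoly MR tR) * hE
  · rw [← hAR]
    refine H.phiPlus_of_append z (L₁ := reflect LL ++ N) (by rw [hH, List.append_assoc]) ?_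
      fun p hp => (Real.exp_lt_exp.1 (hLR p hp)).le
    intro p hp
    rcases List.mem_append.1 hp with hp | hp
    · have := Real.exp_lt_exp.1 (hLL _ (mem_reflect.1 hp))
      simp only at this
      linarith
    · exact (hN p hp).le
  · exact hratio x hx
  · obtain ⟨h1, -⟩ := hroot x hx
    have h0 := hratio x hx
    have hxne : x ≠ 0 := by
      rintro rfl
      rw [eval_zero_rootPoly] at hx0
      exact one_ne_zero hx0
    -- Value and slope of the right solution do not vanish together. Hence the proportionality
    -- factor is nonzero, and the left solution must vanish at `a` too.
    have hres : (residuePoly MR tR).eval x ≠ 0 := by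
      have hmem := (eval_rootPoly_eq_zero hR0).1 hx0
      rw [eval_residuePoly hR0 hmem]
      exact mul_ne_zero (neg_ne_zero.2 (hR x hmem).ne')
        (eval_derivative_rootPoly_ne_zero hR0 hmem)
    rw [hx0, mul_zero, add_zero] at h1
    have hB : x * (sol H.toList).1.eval x ≠ 0 := by
      intro h
      rw [h, zero_mul] at h1
      exact (mul_ne_zero hxne hres) h1
    rw [hx0, eq_comm, mul_eq_zero, or_iff_right (mul_ne_zero (Real.exp_ne_zero a) hB)] at h0
    have h4 := congrArg (eval x) hVL
    simp only [eval_sub, eval_mul, eval_C, eval_X] at h4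
    rw [h4, h0] at h1
    have h5 : (residuePoly MR tR).eval x = -(Real.exp (-a) * (x * (sol H.toList).1.eval x) *
        (residuePoly ML tL).eval x) := by
      refine mul_left_cancel₀ hxne ?_
      linear_combination h1
    rw [residuePoly_smul, residuePoly_smul, eval_mul, eval_mul, eval_C, eval_C, h5]
    ring

theorem exists_split (a : ℝ) (L : List (ℝ × ℝ × ℝ)) (hL : IsNodeList L) :
    ∃ (L₁ N L₂ : List (ℝ × ℝ × ℝ)) (w v : ℝ), L = L₁ ++ (N ++ L₂) ∧ (∀ p ∈ L₁, p.1 < a) ∧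
      (∀ p ∈ N, p.1 = a) ∧ (∀ p ∈ L₂, a < p.1) ∧ 0 ≤ v ∧
      sol (N ++ L₂) = sol ((a, w, v) :: L₂) := by
  -- A fictitious node of zero weight has no effect, so a node at `a` may always be assumed.
  have hz : ∀ L, sol L = sol ((a, 0, 0) :: L) := fun L => by
    simp [sol_cons, weightPoly]
  induction L with
  | nil => exact ⟨[], [], [], 0, 0, rfl, by simp, by simp, by simp, le_rfl, hz _⟩
  | cons p L ih =>
    have hlt := (List.pairwise_cons.1 hL.sorted).1
    rcases lt_trichotomy p.1 a with h | h | h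
    · obtain ⟨L₁, N, L₂, w, v, h1, h2, h3, h4, h5, h6⟩ := ih hL.tail
      exact ⟨p :: L₁, N, L₂, w, v, by rw [h1, List.cons_append],
        List.forall_mem_cons.2 ⟨h, h2⟩, h3, h4, h5, h6⟩
    · obtain ⟨x, w, v⟩ := p
      simp only at h
      subst h
      exact ⟨[], [(x, w, v)], L, w, v, rfl, by simp, by simp, hlt,
        hL.nonneg _ List.mem_cons_self, rfl⟩
    · exact ⟨[], [], p :: L, 0, 0, rfl, by simp, by simp,
        List.forall_mem_cons.2 ⟨h, fun q hq => h.trans (hlt q hq)⟩, le_rfl, hz _⟩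

theorem exists_isSplitting (H : DiscretePair) (a : ℝ) :
    ∃ MR ML tR tL w v, 0 ≤ v ∧ H.IsSplitting a MR ML tR tL w v := by
  obtain ⟨L₁, N, L₂, w, v, h1, h2, h3, h4, h5, h6⟩ := exists_split a _ H.isNodeList_toList
  have hnl := h1 ▸ H.isNodeList_toList
  have hl : ∀ p ∈ reflect L₁, Real.exp (-a) < Real.exp p.1 := fun p hp => by
    have := h2 _ (mem_reflect.1 hp)
    simp only at this
    exact Real.exp_lt_exp.2 (by linarith)
  have hr : ∀ p ∈ L₂, Real.exp a < Real.exp p.1 := fun p hp => Real.exp_lt_exp.2 (h4 p hp)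
  obtain ⟨MR, tR, hR0, hR, hR', hAR, hBR⟩ := exists_valuePoly_eq_rootPoly
    hnl.of_append.2.of_append.2 hr
  obtain ⟨ML, tL, hL0, hL, hL', hAL, hBL⟩ := exists_valuePoly_eq_rootPoly
    hnl.of_append.1.reflect hl
  exact ⟨MR, ML, _, _, w, v, h5, isSplitting_of_toList (by rw [reflect_reflect, h1]) h3 h6 hl hr
    hR0 hL0 hR hL hR' hL' hAR hBR hAL hBL⟩

/-- The inverse theorem is applied on each half line separately, the left one after reflection;
there is no compatibility condition between the two. The residues are rescaled by `exp (∓a)` to undo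
the normalization in `isSplitting_of_toList`. -/
theorem exists_of_splitting (a : ℝ) {MR ML : Finset ℝ} {tR tL : ℝ → ℝ} {w v : ℝ} (hR0 : 0 ∉ MR)
    (hL0 : 0 ∉ ML) (hR : ∀ μ ∈ MR, 0 < tR μ) (hL : ∀ μ ∈ ML, 0 < tL μ)
    (hR' : ∀ μ ∉ MR, tR μ = 0) (hL' : ∀ μ ∉ ML, tL μ = 0) (hv : 0 ≤ v) :
    ∃ H : DiscretePair, H.IsSplitting a MR ML tR tL w v := by
  have hexp : Real.exp a * Real.exp (-a) = 1 := by
    rw [← Real.exp_add, add_neg_cancel, Real.exp_zero]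
  obtain ⟨LR, hLR, hLRs, hAR, hBR⟩ := exists_nodeList _ (t := fun μ => Real.exp (-a) * tR μ) rfl hR0
    (fun μ hμ => mul_pos (Real.exp_pos _) (hR μ hμ)) (Real.exp_pos a).le
  obtain ⟨LL, hLL, hLLs, hAL, hBL⟩ := exists_nodeList _ (t := fun μ => Real.exp a * tL μ) rfl hL0
    (fun μ hμ => mul_pos (Real.exp_pos _) (hL μ hμ)) (Real.exp_pos (-a)).le
  obtain ⟨N, hN, hNa, hNs⟩ : ∃ N : List (ℝ × ℝ × ℝ), IsNodeList N ∧ (∀ p ∈ N, p.1 = a) ∧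
      sol (N ++ LR) = sol ((a, w, v) :: LR) := by
    by_cases h : 0 < |w| + v
    · exact ⟨[(a, w, v)], ⟨by simp, by simpa using hv, by simpa using h⟩, by simp, rfl⟩
    · have h1 := abs_nonneg w
      have hv0 : v = 0 := by linarith
      have hw0 : w = 0 := abs_eq_zero.1 (by linarith)
      exact ⟨[], ⟨by simp, by simp, by simp⟩, by simp, by simp [sol_cons, weightPoly, hv0, hw0]⟩
  have hnl : IsNodeList (reflect LL ++ (N ++ LR)) := by
    refine hLL.reflect.append (hN.append hLR fun p hp q hq => ?_) fun p hp q hq => ?_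
    · rw [hNa p hp]
      exact Real.exp_lt_exp.1 (hLRs q hq)
    · have h1 := Real.exp_lt_exp.1 (hLLs _ (mem_reflect.1 hp))
      simp only at h1
      rcases List.mem_append.1 hq with hq | hq
      · rw [hNa q hq]; linarith
      · have := Real.exp_lt_exp.1 (hLRs q hq); linarith
  obtain ⟨H, hH⟩ := exists_toList_eq hnl
  refine ⟨H, ?_⟩
  have key := isSplitting_of_toList hH hNa hNs hLLs hLRs hR0 hL0
    (fun μ hμ => mul_pos (Real.exp_pos _) (hR μ hμ))
    (fun μ hμ => mul_pos (Real.exp_pos _) (hL μ hμ))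
    (fun μ hμ => by rw [hR' μ hμ, mul_zero]) (fun μ hμ => by rw [hL' μ hμ, mul_zero])
    hAR hBR hAL hBL
  have e1 : (fun μ => Real.exp a * (Real.exp (-a) * tR μ)) = tR :=
    funext fun μ => by rw [← mul_assoc, hexp, one_mul]
  have e2 : (fun μ => Real.exp (-a) * (Real.exp a * tL μ)) = tL :=
    funext fun μ => by rw [← mul_assoc, mul_comm (Real.exp (-a)), hexp, one_mul]
  rwa [e1, e2] at key

end DiscretePair

/-! ### Degrees, common zeros and common denominators -/

namespace KreinString

open Polynomial

theorem natDegree_X_mul_residuePoly_le {M : Finset ℝ} (t : ℝ → ℝ) (h0 : 0 ∉ M) :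
    (X * residuePoly M t).natDegree ≤ M.card := by
  rcases M.eq_empty_or_nonempty with rfl | hM
  · simp
  · have h1 := hM.card_pos
    have h2 := natDegree_residuePoly_le h0 (t := t)
    refine natDegree_mul_le.trans ?_
    rw [natDegree_X]
    omega

theorem coeff_X_mul_residuePoly {M : Finset ℝ} (t : ℝ → ℝ) (h0 : 0 ∉ M) :
    (X * residuePoly M t).coeff M.card = -(∑ μ ∈ M, t μ) * (rootPoly M).coeff M.card := by
  rcases M.eq_empty_or_nonempty with rfl | hM
  · simp
  · rw [← coeff_residuePoly h0]
    obtain ⟨n, hn⟩ : ∃ n, M.card = n + 1 := ⟨M.card - 1, by have := hM.card_pos; omega⟩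
    rw [hn, coeff_X_mul, Nat.add_sub_cancel]

theorem coeff_card_rootPoly_ne_zero {M : Finset ℝ} (h0 : 0 ∉ M) :
    (rootPoly M).coeff M.card ≠ 0 := by
  rw [← natDegree_rootPoly h0]
  exact leadingCoeff_ne_zero.2 rootPoly_ne_zero

theorem eval_zero_residuePoly {M : Finset ℝ} {t : ℝ → ℝ} :
    (residuePoly M t).eval 0 = ∑ μ ∈ M, t μ * μ⁻¹ := by
  simp [residuePoly, eval_finsetSum, eval_zero_rootPoly]

theorem rootPoly_mul_rootPoly (M M' : Finset ℝ) :
    rootPoly M * rootPoly M' = rootPoly (M ∩ M') * rootPoly (M ∪ M') := by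
  rw [mul_comm (rootPoly (M ∩ M'))]
  exact (Finset.prod_union_inter).symm

/-- Bringing a partial fraction to the denominator of the union; the surplus factors are exactly
those of the common zeros. -/
theorem residuePoly_mul_rootPoly_of_off {M M' : Finset ℝ} {t : ℝ → ℝ} (ht : ∀ μ ∉ M, t μ = 0) :
    residuePoly M t * rootPoly M' = rootPoly (M ∩ M') * residuePoly (M ∪ M') t := by
  have h1 : rootPoly M' = rootPoly (M ∩ M') * rootPoly (M' \ M) := by
    rw [← rootPoly_mul_of_disjoint]
    · congr 1
      ext x; simp only [Finset.mem_union, Finset.mem_inter, Finset.mem_sdiff]; tauto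
    · rw [Finset.disjoint_left]
      intro x hx hx'
      exact (Finset.mem_sdiff.1 hx').2 (Finset.mem_inter.1 hx).1
  rw [h1, mul_left_comm, residuePoly_mul_rootPoly Finset.disjoint_sdiff, Finset.union_sdiff_self_eq_union]
  exact fun μ hμ => ht μ (Finset.mem_sdiff.1 hμ).2

theorem rootPoly_injective {M M' : Finset ℝ} (h0 : 0 ∉ M) (h0' : 0 ∉ M')
    (h : rootPoly M = rootPoly M') : M = M' := by
  rw [← Finset.val_inj, ← roots_rootPoly h0, ← roots_rootPoly h0', h]

/-- The common and the total zeros are determined by the product. -/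
theorem inter_union_eq_of_mul_eq {M M' K K' : Finset ℝ} (hM : 0 ∉ M) (hM' : 0 ∉ M') (hK : 0 ∉ K)
    (hK' : 0 ∉ K') (h : rootPoly M * rootPoly M' = rootPoly K * rootPoly K') :
    M ∩ M' = K ∩ K' ∧ M ∪ M' = K ∪ K' := by
  have h1 := congrArg roots h
  rw [roots_mul (mul_ne_zero rootPoly_ne_zero rootPoly_ne_zero),
    roots_mul (mul_ne_zero rootPoly_ne_zero rootPoly_ne_zero), roots_rootPoly hM,
    roots_rootPoly hM', roots_rootPoly hK, roots_rootPoly hK'] at h1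
  have h2 : ∀ x, (if x ∈ M then 1 else 0) + (if x ∈ M' then 1 else 0) =
      (if x ∈ K then 1 else 0) + (if x ∈ K' then 1 else 0) := by
    intro x
    have := congrArg (Multiset.count x) h1
    simpa only [Multiset.count_add, Multiset.count_eq_of_nodup (Finset.nodup _),
      Finset.mem_val] using this
  constructor <;> ext x <;> have := h2 x <;>
    simp only [Finset.mem_inter, Finset.mem_union] <;> split_ifs at this <;> simp_all

end KreinString

/-! ### Spectral data on the line and their relation to a splitting -/

namespace DiscretePair

open Polynomial KreinString

/-- The characteristic polynomial with zeros at `lam`. -/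
noncomputable def eigenPoly {N : ℕ} (lam : Fin N → ℝ) : ℝ[X] := rootPoly (Finset.univ.image lam)

section Eigenvalues

variable {K : DiscretePair} {N : ℕ} {lam : Fin N → ℝ}

/-- The whole line is the half line with left end `-∞`, that is `s = exp (-∞) = 0`, where the value
polynomial becomes the second component of `sol`. -/
theorem HasEigenvalues.exists_residues (hK : K.HasEigenvalues lam) :
    0 ∉ Finset.univ.image lam ∧ (sol K.toList).2 = eigenPoly lam ∧
      ∃ t : ℝ → ℝ, (∀ i, 0 < t (lam i)) ∧
        (sol K.toList).1 = residuePoly (Finset.univ.image lam) t := by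
  obtain ⟨M, t, h0, ht, -, hA, hB⟩ := exists_valuePoly_eq_rootPoly K.isNodeList_toList (s := 0)
    fun p _ => Real.exp_pos _
  have hV : (sol K.toList).2 = rootPoly M := by rw [← hA, valuePoly]; simp
  have hM : M = Finset.univ.image lam := by
    ext x
    have h1 : (x : ℂ) ∈ K.spectrum ↔ x ∈ M := by
      rw [mem_spectrum_iff, hV, aeval_rootPoly_eq_zero h0]
      simp
    rw [← h1, ← hK.2]
    simp
  subst hM
  exact ⟨h0, hV, t, fun i => ht _ (by simp), hB⟩

theorem hasEigenvalues_of_eq (hlam : StrictMono lam) (h0 : 0 ∉ Finset.univ.image lam)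
    (h : (sol K.toList).2 = eigenPoly lam) : K.HasEigenvalues lam := by
  refine ⟨hlam, Set.ext fun z => ?_⟩
  rw [mem_spectrum_iff, h, eigenPoly, aeval_rootPoly_eq_zero h0]
  simp [eq_comm]

namespace HasEigenvalues

theorem zero_notMem (hK : K.HasEigenvalues lam) : 0 ∉ Finset.univ.image lam :=
  hK.exists_residues.1

theorem ne_zero (hK : K.HasEigenvalues lam) (i : Fin N) : lam i ≠ 0 := fun h =>
  hK.zero_notMem (Finset.mem_image.2 ⟨i, Finset.mem_univ _, h⟩)

theorem charPoly_eq (hK : K.HasEigenvalues lam) : (sol K.toList).2 = eigenPoly lam :=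
  hK.exists_residues.2.1

theorem eval_charPoly (hK : K.HasEigenvalues lam) (i : Fin N) :
    (sol K.toList).2.eval (lam i) = 0 := by
  rw [hK.charPoly_eq, eigenPoly, eval_rootPoly_eq_zero hK.zero_notMem]
  simp

theorem exists_of_eval_charPoly (hK : K.HasEigenvalues lam) {x : ℝ}
    (hx : (sol K.toList).2.eval x = 0) : ∃ i, lam i = x := by
  rw [hK.charPoly_eq, eigenPoly, eval_rootPoly_eq_zero hK.zero_notMem] at hx
  simpa using hx

theorem eval_derivative_ne_zero (hK : K.HasEigenvalues lam) (i : Fin N) :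
    (derivative (eigenPoly lam)).eval (lam i) ≠ 0 :=
  eval_derivative_rootPoly_ne_zero hK.zero_notMem (by simp)

theorem card_image (hK : K.HasEigenvalues lam) : (Finset.univ.image lam).card = N := by
  rw [Finset.card_image_of_injective _ hK.1.injective, Finset.card_univ, Fintype.card_fin]

theorem gammaSq_eq (hK : K.HasEigenvalues lam) (i : Fin N) :
    lam i * K.gammaSq (lam i) = -(lam i * (lam i * (sol K.toList).1.eval (lam i)) *
      (derivative (eigenPoly lam)).eval (lam i)) := by
  have h := hK.eval_charPoly i
  rw [DiscretePair.gammaSq_eq, ← hK.charPoly_eq]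
  simp only [eval_sub, eval_mul, eval_X, h]
  ring

theorem gammaSq_pos (hK : K.HasEigenvalues lam) (i : Fin N) :
    0 < lam i * K.gammaSq (lam i) := by
  obtain ⟨h0, -, t, ht, hB⟩ := hK.exists_residues
  have h1 : (sol K.toList).1.eval (lam i) =
      -t (lam i) * (derivative (eigenPoly lam)).eval (lam i) := by
    rw [hB, eval_residuePoly h0 (by simp)]
    rfl
  rw [hK.gammaSq_eq, h1]
  have := mul_pos (ht i) (mul_pos (sq_pos_iff.2 (hK.ne_zero i))
    (sq_pos_iff.2 (hK.eval_derivative_ne_zero i)))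
  linarith

/-- A pair is determined by its spectral data. -/
theorem eq_of_gammaSq_eq {K' : DiscretePair} (hK : K.HasEigenvalues lam)
    (hK' : K'.HasEigenvalues lam)
    (h : ∀ i, lam i * K.gammaSq (lam i) = lam i * K'.gammaSq (lam i)) : K = K' := by
  refine toList_injective (sol_injective K.isNodeList_toList K'.isNodeList_toList ?_)
  refine Prod.ext ?_ (by rw [hK.charPoly_eq, hK'.charPoly_eq])
  obtain ⟨h0, -, t, -, hB⟩ := hK.exists_residues
  obtain ⟨-, -, t', -, hB'⟩ := hK'.exists_residues
  rw [hB, hB']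
  refine residuePoly_congr fun μ hμ => ?_
  obtain ⟨i, -, rfl⟩ := Finset.mem_image.1 hμ
  have h1 := h i
  rw [hK.gammaSq_eq, hK'.gammaSq_eq, hB, hB', eval_residuePoly h0 hμ, eval_residuePoly h0 hμ]
    at h1
  have h2 := hK.eval_derivative_ne_zero i
  have h3 := hK.ne_zero i
  rw [eigenPoly] at h1 h2
  have h4 : t (lam i) * (lam i ^ 2 *
      (derivative (rootPoly (Finset.univ.image lam))).eval (lam i) ^ 2) =
      t' (lam i) * (lam i ^ 2 *
      (derivative (rootPoly (Finset.univ.image lam))).eval (lam i) ^ 2) := by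
    linear_combination h1
  exact mul_right_cancel₀ (mul_ne_zero (pow_ne_zero 2 h3) (pow_ne_zero 2 h2)) h4

end HasEigenvalues

end Eigenvalues

namespace IsSplitting

variable {H K : DiscretePair} {a : ℝ} {MR ML : Finset ℝ} {tR tL : ℝ → ℝ} {w v : ℝ} {N : ℕ}
  {lam : Fin N → ℝ}

/-- The source of non-uniqueness: left and right enter only through the common zeros, all zeros and
the summed residues. -/
theorem charPoly_eq_mul (h : H.IsSplitting a MR ML tR tL w v) : (sol H.toList).2 =
    rootPoly (MR ∩ ML) * (rootPoly (MR ∪ ML) - X * (residuePoly (MR ∪ ML) (fun μ => tR μ + tL μ) +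
      (C w + C v * X) * rootPoly (MR ∪ ML))) := by
  have h1 := residuePoly_mul_rootPoly_of_off (M' := ML) h.right_off
  have h2 := residuePoly_mul_rootPoly_of_off (M' := MR) h.left_off
  rw [Finset.inter_comm, Finset.union_comm] at h2
  rw [h.charPoly_eq, h1, h2, rootPoly_mul_rootPoly, residuePoly_add]
  ring

/-- The node at `a` raises the degree by two if `v ≠ 0` and by one if `v = 0 ≠ w`. Without a node
there is no cancellation, as the top coefficient carries the factor `1 + ∑ tR + ∑ tL > 0`. -/
theorem natDegree_charPoly (h : H.IsSplitting a MR ML tR tL w v) :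
    MR.card + ML.card ≤ (sol H.toList).2.natDegree ∧
      (sol H.toList).2.natDegree ≤ MR.card + ML.card + 2 := by
  have hR := natDegree_rootPoly h.right_zero
  have hL := natDegree_rootPoly h.left_zero
  have hcR := coeff_card_rootPoly_ne_zero h.right_zero
  have hcL := coeff_card_rootPoly_ne_zero h.left_zero
  have hXR := natDegree_X_mul_residuePoly_le tR h.right_zero
  have hXL := natDegree_X_mul_residuePoly_le tL h.left_zero
  have hxR := coeff_X_mul_residuePoly tR h.right_zero
  have hxL := coeff_X_mul_residuePoly tL h.left_zero
  have hW : (sol H.toList).2 = rootPoly MR * rootPoly ML - (X * residuePoly MR tR) * rootPoly ML -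
      rootPoly MR * (X * residuePoly ML tL) - (rootPoly MR * rootPoly ML) * (C w * X) -
        (rootPoly MR * rootPoly ML) * (C v * X ^ 2) := by
    rw [h.charPoly_eq]; ring
  have hP : (rootPoly MR * rootPoly ML).natDegree ≤ MR.card + ML.card :=
    natDegree_mul_le.trans (by rw [hR, hL])
  have hwX : (C w * X : ℝ[X]).natDegree ≤ 1 := (natDegree_C_mul_le _ _).trans natDegree_X_le
  have d1 : ((X * residuePoly MR tR) * rootPoly ML).natDegree ≤ MR.card + ML.card :=
    natDegree_mul_le.trans (by rw [hL]; omega)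
  have d2 : (rootPoly MR * (X * residuePoly ML tL)).natDegree ≤ MR.card + ML.card :=
    natDegree_mul_le.trans (by rw [hR]; omega)
  have d3 : ((rootPoly MR * rootPoly ML) * (C w * X)).natDegree ≤ MR.card + ML.card + 1 :=
    natDegree_mul_le.trans (add_le_add hP hwX)
  have d4 : ((rootPoly MR * rootPoly ML) * (C v * X ^ 2)).natDegree ≤ MR.card + ML.card + 2 :=
    natDegree_mul_le.trans (add_le_add hP (natDegree_C_mul_X_pow_le v 2))
  have cP : (rootPoly MR * rootPoly ML).coeff (MR.card + ML.card) =
      (rootPoly MR).coeff MR.card * (rootPoly ML).coeff ML.card :=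
    coeff_mul_add_eq_of_natDegree_le hR.le hL.le
  have c1 : ((X * residuePoly MR tR) * rootPoly ML).coeff (MR.card + ML.card) =
      -(∑ μ ∈ MR, tR μ) * (rootPoly MR).coeff MR.card * (rootPoly ML).coeff ML.card := by
    rw [coeff_mul_add_eq_of_natDegree_le hXR hL.le, hxR]
  have c2 : (rootPoly MR * (X * residuePoly ML tL)).coeff (MR.card + ML.card) =
      (rootPoly MR).coeff MR.card * (-(∑ μ ∈ ML, tL μ) * (rootPoly ML).coeff ML.card) := by
    rw [coeff_mul_add_eq_of_natDegree_le hR.le hXL, hxL]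
  have hz : ∀ {p : ℝ[X]} {m n : ℕ}, p.natDegree ≤ m → m < n → p.coeff n = 0 := fun h1 h2 =>
    coeff_eq_zero_of_natDegree_lt (h1.trans_lt h2)
  constructor
  · rcases eq_or_ne v 0 with hv | hv
    · rcases eq_or_ne w 0 with hw | hw
      · refine le_natDegree_of_ne_zero ?_
        have hTR : 0 ≤ ∑ μ ∈ MR, tR μ := Finset.sum_nonneg fun μ hμ => (h.right_pos μ hμ).le
        have hTL : 0 ≤ ∑ μ ∈ ML, tL μ := Finset.sum_nonneg fun μ hμ => (h.left_pos μ hμ).le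
        have : (sol H.toList).2.coeff (MR.card + ML.card) = (rootPoly MR).coeff MR.card *
            (rootPoly ML).coeff ML.card * (1 + ∑ μ ∈ MR, tR μ + ∑ μ ∈ ML, tL μ) := by
          rw [hW, hv, hw]
          simp only [C_0, zero_mul, mul_zero, sub_zero]
          rw [coeff_sub, coeff_sub, cP, c1, c2]
          ring
        rw [this]
        exact mul_ne_zero (mul_ne_zero hcR hcL) (by positivity)
      · refine (Nat.le_succ _).trans (le_natDegree_of_ne_zero ?_)
        rw [hW, hv]
        simp only [C_0, zero_mul, mul_zero, sub_zero, Nat.succ_eq_add_one]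
        rw [coeff_sub, coeff_sub, coeff_sub, hz hP (Nat.lt_succ_self _), hz d1 (Nat.lt_succ_self _),
          hz d2 (Nat.lt_succ_self _), coeff_mul_add_eq_of_natDegree_le hP hwX, cP]
        simp [hcR, hcL, hw]
    · refine (Nat.le_add_right _ 2).trans (le_natDegree_of_ne_zero ?_)
      rw [hW, coeff_sub, coeff_sub, coeff_sub, coeff_sub, hz hP (by omega), hz d1 (by omega),
        hz d2 (by omega), hz d3 (by omega),
        coeff_mul_add_eq_of_natDegree_le hP (natDegree_C_mul_X_pow_le v 2), cP]
      simp [hcR, hcL, hv]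
  · rw [hW]
    refine (natDegree_sub_le_of_le (natDegree_sub_le_of_le (natDegree_sub_le_of_le
      (natDegree_sub_le_of_le hP d1) d2) d3) d4).trans ?_
    omega

theorem norm_normEigenfun_sq (h : K.IsSplitting a MR ML tR tL w v) (hK : K.HasEigenvalues lam)
    (i : Fin N) : ‖K.normEigenfun (lam i) a‖ ^ 2 * (lam i * K.gammaSq (lam i)) =
      Real.exp (-a) * (rootPoly MR).eval (lam i) ^ 2 := by
  have hpos := hK.gammaSq_pos i
  have hsq : Real.exp (-a / 2) ^ 2 = Real.exp (-a) := by
    rw [← Real.exp_nat_mul]; congr 1; push_cast; ring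
  have hreal : aeval ((lam i : ℝ) : ℂ) (rootPoly MR) = (((rootPoly MR).eval (lam i) : ℝ) : ℂ) := by
    rw [← coe_aeval_eq_eval]
    exact aeval_algebraMap_apply ℂ (lam i) _
  rw [normEigenfun, h.phiPlus_eq, hreal, ← Complex.ofReal_mul, ← Complex.ofReal_div,
    Complex.norm_real, Real.norm_eq_abs, sq_abs, div_pow, Real.sq_sqrt hpos.le, mul_pow, hsq,
    div_mul_cancel₀ _ hpos.ne']

theorem slope_ne_zero (hK : K.HasEigenvalues lam) (i : Fin N) :
    lam i * (sol K.toList).1.eval (lam i) ≠ 0 := by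
  intro h
  have h1 := hK.gammaSq_pos i
  rw [hK.gammaSq_eq, h] at h1
  simp at h1

theorem eval_rootPoly_eq_zero_iff (h : K.IsSplitting a MR ML tR tL w v)
    (hK : K.HasEigenvalues lam) (i : Fin N) :
    (rootPoly MR).eval (lam i) = 0 ↔ (rootPoly ML).eval (lam i) = 0 := by
  rw [h.ratio _ (hK.eval_charPoly i), mul_eq_zero,
    or_iff_right (mul_ne_zero (Real.exp_ne_zero a) (slope_ne_zero hK i))]

theorem normEigenfun_eq_zero_iff (h : K.IsSplitting a MR ML tR tL w v)
    (hK : K.HasEigenvalues lam) (i : Fin N) :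
    K.normEigenfun (lam i) a = 0 ↔ lam i ∈ MR := by
  have h1 := h.norm_normEigenfun_sq hK i
  have hpos := hK.gammaSq_pos i
  rw [← eval_rootPoly_eq_zero h.right_zero, ← norm_eq_zero]
  constructor
  · intro h2
    rw [h2] at h1
    simpa using h1.symm
  · intro h2
    rw [h2] at h1
    simpa [hpos.ne'] using h1

/-- The residues of the diagonal Green function. Eliminating the slope of `φ₊` between `gammaSq_eq`
and `ratio` leaves only the characteristic polynomial and the symmetric product of the denominators.
-/
theorem norm_normEigenfun_sq_mul (h : K.IsSplitting a MR ML tR tL w v)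
    (hK : K.HasEigenvalues lam) (i : Fin N) :
    ‖K.normEigenfun (lam i) a‖ ^ 2 * (lam i * (derivative (eigenPoly lam)).eval (lam i)) =
      -(rootPoly MR * rootPoly ML).eval (lam i) := by
  have h1 := h.norm_normEigenfun_sq hK i
  have h2 := h.ratio _ (hK.eval_charPoly i)
  rw [hK.gammaSq_eq] at h1
  have h3 := slope_ne_zero hK i
  have hexp : Real.exp (-a) * Real.exp a = 1 := by
    rw [← Real.exp_add, neg_add_cancel, Real.exp_zero]
  refine mul_left_cancel₀ h3 ?_
  rw [eval_mul]
  linear_combination -h1 - Real.exp (-a) * (rootPoly MR).eval (lam i) * h2 -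
    (rootPoly MR).eval (lam i) * (lam i * (sol K.toList).1.eval (lam i)) *
      (rootPoly ML).eval (lam i) * hexp

/-- A common zero of the denominators is a zero of the characteristic polynomial, hence an
eigenvalue. Conversely, at an eigenvalue `ratio` makes both denominators vanish together. -/
theorem mem_inter_iff (h : K.IsSplitting a MR ML tR tL w v) (hK : K.HasEigenvalues lam) (x : ℝ) :
    x ∈ MR ∩ ML ↔ ∃ i, K.normEigenfun (lam i) a = 0 ∧ lam i = x := by
  constructor
  · intro hx
    obtain ⟨hxR, hxL⟩ := Finset.mem_inter.1 hx
    obtain ⟨i, rfl⟩ := hK.exists_of_eval_charPoly (x := x) (by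
      rw [h.charPoly_eq]
      simp [(eval_rootPoly_eq_zero h.right_zero).2 hxR, (eval_rootPoly_eq_zero h.left_zero).2 hxL])
    exact ⟨i, (h.normEigenfun_eq_zero_iff hK i).2 hxR, rfl⟩
  · rintro ⟨i, hi, rfl⟩
    have hR := (h.normEigenfun_eq_zero_iff hK i).1 hi
    refine Finset.mem_inter.2 ⟨hR, ?_⟩
    rw [← eval_rootPoly_eq_zero h.left_zero, ← h.eval_rootPoly_eq_zero_iff hK,
      eval_rootPoly_eq_zero h.right_zero]
    exact hR

theorem card_add_card (h : K.IsSplitting a MR ML tR tL w v) (hK : K.HasEigenvalues lam) :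
    MR.card + ML.card ≤ N ∧ N ≤ MR.card + ML.card + 2 := by
  have h1 := h.natDegree_charPoly
  rwa [hK.charPoly_eq, eigenPoly, natDegree_rootPoly hK.zero_notMem, hK.card_image] at h1

theorem natDegree_mul (h : K.IsSplitting a MR ML tR tL w v) :
    (rootPoly MR * rootPoly ML).natDegree = MR.card + ML.card := by
  rw [Polynomial.natDegree_mul rootPoly_ne_zero rootPoly_ne_zero, natDegree_rootPoly h.right_zero,
    natDegree_rootPoly h.left_zero]

/-- Interpolation at `N + 1` points: the normalization at `0` supplies the one condition that the
`N` eigenvalues lack. -/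
theorem eq_of_eval_eq (hlam : 0 ∉ Finset.univ.image lam) (hinj : Function.Injective lam)
    {p q : ℝ[X]} (hp : p.natDegree ≤ N) (hq : q.natDegree ≤ N) (h0 : p.eval 0 = q.eval 0)
    (h : ∀ i, p.eval (lam i) = q.eval (lam i)) : p = q := by
  have hcard : (insert 0 (Finset.univ.image lam)).card = N + 1 := by
    rw [Finset.card_insert_of_notMem hlam, Finset.card_image_of_injective _ hinj, Finset.card_univ,
      Fintype.card_fin]
  have hlt : ∀ f : ℝ[X], f.natDegree ≤ N → f.degree < (insert 0 (Finset.univ.image lam)).card := by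
    intro f hf
    rw [hcard]
    exact degree_le_natDegree.trans_lt (by exact_mod_cast Nat.lt_succ_of_le hf)
  refine eq_of_degrees_lt_of_eval_finset_eq _ (hlt p hp) (hlt q hq) fun x hx => ?_
  rcases Finset.mem_insert.1 hx with rfl | hx
  · exact h0
  · obtain ⟨i, -, rfl⟩ := Finset.mem_image.1 hx
    exact h i

/-- The product of the denominators is determined by the eigenvalues and the absolute values of
the normalized eigenfunctions. -/
theorem mul_eq_mul (h : H.IsSplitting a MR ML tR tL w v) (hH : H.HasEigenvalues lam)
    {MR' ML' : Finset ℝ} {tR' tL' : ℝ → ℝ} {w' v' : ℝ}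
    (h' : K.IsSplitting a MR' ML' tR' tL' w' v') (hK : K.HasEigenvalues lam)
    (hn : ∀ i, ‖K.normEigenfun (lam i) a‖ = ‖H.normEigenfun (lam i) a‖) :
    rootPoly MR' * rootPoly ML' = rootPoly MR * rootPoly ML := by
  refine eq_of_eval_eq hH.zero_notMem hH.1.injective ?_ ?_ ?_ fun i => ?_
  · rw [h'.natDegree_mul]; exact (h'.card_add_card hK).1
  · rw [h.natDegree_mul]; exact (h.card_add_card hH).1
  · simp [eval_zero_rootPoly]
  · have h1 := h.norm_normEigenfun_sq_mul hH i
    have h2 := h'.norm_normEigenfun_sq_mul hK i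
    rw [hn] at h2
    linarith

/-- Partial fractions of the diagonal Green function at `a`. -/
theorem mul_eq_residuePoly (h : H.IsSplitting a MR ML tR tL w v) (hH : H.HasEigenvalues lam)
    {ρ : ℝ → ℝ} (hρ : ∀ i, ρ (lam i) = ‖H.normEigenfun (lam i) a‖ ^ 2) {α : ℝ}
    (hα : α = 1 - ∑ i, ‖H.normEigenfun (lam i) a‖ ^ 2) :
    rootPoly MR * rootPoly ML =
      C α * eigenPoly lam + residuePoly (Finset.univ.image lam) fun μ => μ * ρ μ := by
  have h0 := hH.zero_notMem
  refine eq_of_eval_eq h0 hH.1.injective ?_ ?_ ?_ fun i => ?_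
  · rw [h.natDegree_mul]; exact (h.card_add_card hH).1
  · refine natDegree_add_le_of_degree_le ((natDegree_C_mul_le _ _).trans ?_)
      ((natDegree_residuePoly_le h0).trans ?_)
    · rw [eigenPoly, natDegree_rootPoly h0, hH.card_image]
    · rw [hH.card_image]; omega
  · rw [eval_mul, eval_zero_rootPoly, eval_zero_rootPoly, eval_add, eval_mul, eval_C, eigenPoly,
      eval_zero_rootPoly, eval_zero_residuePoly, Finset.sum_image fun i _ j _ hij => hH.1.injective hij]
    have : ∑ i, lam i * ρ (lam i) * (lam i)⁻¹ = ∑ i, ‖H.normEigenfun (lam i) a‖ ^ 2 := by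
      refine Finset.sum_congr rfl fun i _ => ?_
      have := hH.ne_zero i
      rw [hρ]
      field_simp
    rw [this, hα]
    ring
  · have h1 := h.norm_normEigenfun_sq_mul hH i
    have h2 := hH.eval_charPoly i
    rw [hH.charPoly_eq] at h2
    rw [eval_add, eval_mul (p := C α), h2, eval_residuePoly h0 (by simp), hρ]
    rw [eigenPoly] at h1
    linarith

/-- In `mul_eq_residuePoly` the coefficient of `X ^ N` is `α` times a nonzero number and, if `α =
0`, that of `X ^ (N - 1)` is `β` times the same number. If both vanish, the lower bound in
`card_add_card` leaves only `N - 2`. -/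
theorem card_add_card_eq (h : H.IsSplitting a MR ML tR tL w v) (hH : H.HasEigenvalues lam)
    {α β : ℝ} (hα : α = 1 - ∑ i, ‖H.normEigenfun (lam i) a‖ ^ 2)
    (hβ : β = -∑ i, lam i * ‖H.normEigenfun (lam i) a‖ ^ 2) :
    (α ≠ 0 → MR.card + ML.card = N) ∧ (α = 0 → β ≠ 0 → MR.card + ML.card + 1 = N) ∧
      (α = 0 → β = 0 → MR.card + ML.card + 2 = N) := by
  have h0 := hH.zero_notMem
  have hinj := hH.1.injective
  set ρ : ℝ → ℝ := Function.extend lam (fun i => ‖H.normEigenfun (lam i) a‖ ^ 2) 0 with hρdef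
  have hρ : ∀ i, ρ (lam i) = ‖H.normEigenfun (lam i) a‖ ^ 2 := fun i => hinj.extend_apply _ _ i
  have hP := h.mul_eq_residuePoly hH hρ hα
  have hd := h.natDegree_mul
  have hle := h.card_add_card hH
  have hPne : rootPoly MR * rootPoly ML ≠ 0 := mul_ne_zero rootPoly_ne_zero rootPoly_ne_zero
  have hlc := coeff_card_rootPoly_ne_zero h0
  have hdeg : (residuePoly (Finset.univ.image lam) fun μ => μ * ρ μ).degree < N := by
    have := degree_residuePoly_lt h0 (t := fun μ => μ * ρ μ)
    rwa [hH.card_image] at this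
  have hcoeff : (residuePoly (Finset.univ.image lam) fun μ => μ * ρ μ).coeff (N - 1) =
      β * (eigenPoly lam).coeff N := by
    have := coeff_residuePoly h0 (t := fun μ => μ * ρ μ)
    rw [hH.card_image, Finset.sum_image fun i _ j _ hij => hinj hij] at this
    rw [this, hβ, eigenPoly]
    simp only [hρ]
  rw [hH.card_image] at hlc
  rw [← hd] at hle ⊢
  refine ⟨fun hne => ?_, fun hz hne => ?_, fun hz hz' => ?_⟩
  · refine le_antisymm hle.1 (le_natDegree_of_ne_zero ?_)
    rw [hP, coeff_add, coeff_C_mul, coeff_eq_zero_of_degree_lt hdeg, add_zero]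
    exact mul_ne_zero hne hlc
  all_goals
    rw [hz, C_0, zero_mul, zero_add] at hP
    rw [← hP] at hdeg hcoeff
    have hlt := (natDegree_lt_iff_degree_lt hPne).2 hdeg
  · have : N - 1 ≤ (rootPoly MR * rootPoly ML).natDegree := by
      refine le_natDegree_of_ne_zero ?_
      rw [hcoeff]
      exact mul_ne_zero hne hlc
    omega
  · have : (rootPoly MR * rootPoly ML).natDegree ≠ N - 1 := by
      intro h1
      rw [hz', zero_mul, ← h1, coeff_natDegree, leadingCoeff_eq_zero] at hcoeff
      exact hPne hcoeff
    omega

end IsSplitting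

end DiscretePair

/-! ### Open orthants as disjoint manifolds -/

section Orthant

variable {N : ℕ} {lam : Fin N → ℝ} {Z : Set (Fin N)}

/-- An open orthant in a coordinate subspace: the coordinates in `Z` of the second component are
positive, all other coordinates are prescribed. -/
def orthantPiece (lam : Fin N → ℝ) (Z : Set (Fin N)) (c : Fin N → ℝ) :
    Set ((Fin N → ℝ) × (Fin N → ℝ)) :=
  {q | q.1 = lam ∧ (∀ i, i ∉ Z → q.2 i = c i) ∧ ∀ i ∈ Z, 0 < q.2 i}

theorem isConnected_orthantPiece (c : Fin N → ℝ) : IsConnected (orthantPiece lam Z c) := by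
  classical
  refine ⟨⟨(lam, fun i => if i ∈ Z then 1 else c i), rfl, fun i hi => by simp [hi],
    fun i hi => by simp [hi]⟩, Convex.isPreconnected ?_⟩
  rintro p ⟨hp1, hp2, hp3⟩ q ⟨hq1, hq2, hq3⟩ s t hs ht hst
  refine ⟨?_, fun i hi => ?_, fun i hi => ?_⟩
  · simp [hp1, hq1, ← add_smul, hst]
  · simp [hp2 i hi, hq2 i hi, ← add_mul, hst]
  · simp only [Prod.snd_add, Prod.smul_snd, Pi.add_apply, Pi.smul_apply, smul_eq_mul]
    rcases hs.eq_or_lt with rfl | hs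
    · rw [zero_add] at hst
      simpa [hst] using hq3 i hi
    · have h1 := mul_pos hs (hp3 i hi)
      have h2 := mul_nonneg ht (hq3 i hi).le
      linarith

theorem infinite_orthantPiece (c : Fin N → ℝ) (hZ : Z.Nonempty) :
    (orthantPiece lam Z c).Infinite := by
  classical
  obtain ⟨i₀, hi₀⟩ := hZ
  refine Set.infinite_of_injective_forall_mem (f := fun n : ℕ =>
    (lam, fun i => if i ∈ Z then (n : ℝ) + 1 else c i)) (fun m n h => ?_)
    fun n => ⟨rfl, fun i hi => by simp [hi], fun i hi => by simp only [hi, if_true]; positivity⟩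
  have := congrFun (congrArg Prod.snd h) i₀
  simpa [hi₀] using this

/-- The chart is translation by `-p`, restricted to the open set where the free coordinates are
positive; there the piece is an affine coordinate subspace. -/
theorem isEmbeddedSubmanifold_orthantPiece (c : Fin N → ℝ) :
    IsEmbeddedSubmanifold Z.ncard (orthantPiece lam Z c) := by
  classical
  rintro p ⟨hp1, hp2, hp3⟩
  set f : (Z → ℝ) →ₗ[ℝ] (Fin N → ℝ) × (Fin N → ℝ) :=
    (LinearMap.inr ℝ (Fin N → ℝ) (Fin N → ℝ)).comp
      (Function.ExtendByZero.linearMap ℝ (Subtype.val : Z → Fin N)) with hf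
  have hf1 : ∀ g, f g = (0, Function.extend Subtype.val g 0) := fun g => rfl
  have hfinj : Function.Injective f := by
    intro g g' h
    rw [hf1, hf1] at h
    funext i
    have := congrFun (congrArg Prod.snd h) i.1
    simpa [Subtype.val_injective.extend_apply] using this
  have hmem : ∀ q, q ∈ LinearMap.range f ↔ q.1 = 0 ∧ ∀ i, i ∉ Z → q.2 i = 0 := by
    intro q
    constructor
    · rintro ⟨g, rfl⟩
      refine ⟨rfl, fun i hi => ?_⟩
      rw [hf1]
      exact Function.extend_apply' _ _ _ fun ⟨j, hj⟩ => hi (hj ▸ j.2)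
    · rintro ⟨h1, h2⟩
      refine ⟨fun i => q.2 i.1, ?_⟩
      rw [hf1]
      refine Prod.ext h1.symm (funext fun i => ?_)
      by_cases hi : i ∈ Z
      · exact Subtype.val_injective.extend_apply (fun i : Z => q.2 i.1) 0 (⟨i, hi⟩ : Z)
      · rw [h2 i hi]
        have hni : ¬∃ j : Z, j.1 = i := by
          rintro ⟨j, rfl⟩
          exact hi j.2
        exact Function.extend_apply' (fun i : Z => q.2 i.1) (0 : Fin N → ℝ) i hni
  have hU : IsOpen {q : (Fin N → ℝ) × (Fin N → ℝ) | ∀ i ∈ Z, 0 < q.2 i} := by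
    have : {q : (Fin N → ℝ) × (Fin N → ℝ) | ∀ i ∈ Z, 0 < q.2 i} =
        ⋂ i : Fin N, {q | i ∈ Z → 0 < q.2 i} := by ext; simp
    rw [this]
    refine isOpen_iInter_of_finite fun i => ?_
    by_cases hi : i ∈ Z
    · simp only [hi, forall_const]
      exact isOpen_lt continuous_const ((continuous_apply i).comp continuous_snd)
    · simp [hi]
  refine ⟨LinearMap.range f, (Homeomorph.subRight p).toOpenPartialHomeomorphOfImageEq _ hU _ rfl,
    ?_, hp3, ?_, ?_, ?_⟩
  · rw [LinearMap.finrank_range_of_inj hfinj, Module.finrank_fintype_fun_eq_card,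
      ← Nat.card_eq_fintype_card, Nat.card_coe_set_eq]
  · exact (contDiff_id.sub contDiff_const).contDiffOn
  · exact (contDiff_id.add contDiff_const).contDiffOn
  · ext u
    constructor
    · rintro ⟨q, ⟨⟨hq1, hq2, -⟩, hqU⟩, rfl⟩
      refine ⟨(hmem _).2 ⟨?_, fun i hi => ?_⟩, q, hqU, rfl⟩
      · change q.1 - p.1 = 0
        rw [hq1, hp1, sub_self]
      · change q.2 i - p.2 i = 0
        rw [hq2 i hi, hp2 i hi, sub_self]
    · rintro ⟨hu, q, hqU, rfl⟩
      obtain ⟨h1, h2⟩ := (hmem _).1 hu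
      refine ⟨q, ⟨⟨?_, fun i hi => ?_, hqU⟩, hqU⟩, rfl⟩
      · rw [← hp1]
        exact sub_eq_zero.1 h1
      · rw [← hp2 i hi]
        exact sub_eq_zero.1 (h2 i hi)

theorem isDisjointManifolds_of_orthantPieces {ι : Type*} [Fintype ι]
    {S : Set ((Fin N → ℝ) × (Fin N → ℝ))} {c : ι → Fin N → ℝ}
    (hS : S = ⋃ j, orthantPiece lam Z (c j))
    (hd : ∀ i j, i ≠ j → Disjoint (orthantPiece lam Z (c i)) (orthantPiece lam Z (c j))) :
    IsDisjointManifolds (Fintype.card ι) Z.ncard S := by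
  set e := (Fintype.equivFin ι).symm
  refine ⟨fun j => orthantPiece lam Z (c (e j)), ?_, fun i j hij => hd _ _ (e.injective.ne hij),
    fun j => ⟨isConnected_orthantPiece _, isEmbeddedSubmanifold_orthantPiece _, ?_⟩⟩
  · rw [hS]
    exact (e.surjective.iUnion_comp fun j => orthantPiece lam Z (c j)).symm
  -- The open set removes the finitely many closed coordinate subspaces carrying the other pieces.
  -- None of them meets the piece `e j`: a common point has positive free coordinates and would lie
  -- in both pieces.
  · refine ⟨⋂ i : {i // i ≠ e j}, {q | ∀ l, l ∉ Z → q.2 l = c i.1 l}ᶜ, ?_, ?_⟩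
    · refine isOpen_iInter_of_finite fun i => IsClosed.isOpen_compl (self := ?_)
      have : {q : (Fin N → ℝ) × (Fin N → ℝ) | ∀ l, l ∉ Z → q.2 l = c i.1 l} =
          ⋂ (l : Fin N) (_ : l ∉ Z), {q | q.2 l = c i.1 l} := by ext; simp
      rw [this]
      exact isClosed_iInter fun l => isClosed_iInter fun _ =>
        isClosed_eq ((continuous_apply l).comp continuous_snd) continuous_const
    · ext q
      constructor
      · intro hq
        refine ⟨hS ▸ Set.mem_iUnion.2 ⟨_, hq⟩, Set.mem_iInter.2 fun i hi => ?_⟩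
        exact Set.disjoint_left.1 (hd _ _ i.2) ⟨hq.1, hi, hq.2.2⟩ hq
      · rintro ⟨hq, hq'⟩
        rw [hS] at hq
        obtain ⟨i, hi⟩ := Set.mem_iUnion.1 hq
        by_cases hij : i = e j
        · rwa [hij] at hi
        · exact absurd hi.2.1 (Set.mem_iInter.1 hq' ⟨i, hij⟩)

end Orthant

/-! ### The spectral data of the inverse family -/

namespace DiscretePair

open Polynomial KreinString

/-- The value of `lam i * γ_i ^ 2` if `M` is the set of zeros of `φ₊(·, a)` and `r i ≠ 0`. -/
noncomputable def normingValue (a : ℝ) {N : ℕ} (lam r : Fin N → ℝ) (M : Finset ℝ) (i : Fin N) : ℝ :=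
  Real.exp (-a) * (rootPoly M).eval (lam i) ^ 2 / r i ^ 2

namespace IsSplitting

variable {H K : DiscretePair} {a : ℝ} {MR ML : Finset ℝ} {tR tL : ℝ → ℝ} {w v : ℝ} {N : ℕ}
  {lam r : Fin N → ℝ}

theorem eq_normingValue (h : K.IsSplitting a MR ML tR tL w v) (hK : K.HasEigenvalues lam)
    {i : Fin N} (hn : ‖K.normEigenfun (lam i) a‖ = r i) (hi : r i ≠ 0) :
    lam i * K.gammaSq (lam i) = normingValue a lam r MR i := by
  rw [normingValue, ← h.norm_normEigenfun_sq hK, hn]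
  field_simp

theorem mem_orthantPiece (h : H.IsSplitting a MR ML tR tL w v) (hH : H.HasEigenvalues lam)
    (hr : ∀ i, r i = ‖H.normEigenfun (lam i) a‖) (hK : K ∈ inverseFamily a lam r) :
    ∃ σ ⊆ (MR ∪ ML) \ (MR ∩ ML), (lam, fun i => lam i * K.gammaSq (lam i)) ∈
      orthantPiece lam {i | r i = 0} (normingValue a lam r (MR ∩ ML ∪ σ)) := by
  obtain ⟨hKe, hKn⟩ := hK
  obtain ⟨MR', ML', tR', tL', w', v', -, h'⟩ := K.exists_isSplitting a
  obtain ⟨h1, h2⟩ := inter_union_eq_of_mul_eq h'.right_zero h'.left_zero h.right_zero h.left_zero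
    (h.mul_eq_mul hH h' hKe fun i => by rw [hKn, hr])
  refine ⟨MR' \ (MR ∩ ML), ?_, rfl, fun i hi => ?_, fun i _ => hKe.gammaSq_pos i⟩
  · rw [← h1, ← h2]
    exact Finset.sdiff_subset_sdiff Finset.subset_union_left le_rfl
  · rw [Finset.union_sdiff_of_subset (h1 ▸ Finset.inter_subset_left)]
    exact h'.eq_normingValue hKe (hKn i) hi

/-- The common zeros, all zeros, the summed residues and the weights at `a` are kept, so the
eigenvalues and the `|φᵢ(a)|` persist. The poles in `σ` go to the right, the other non-common ones
to the left, and at the common poles the ratio of the residues is tuned to produce `κ`. -/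
theorem exists_of_mem_orthantPiece (h : H.IsSplitting a MR ML tR tL w v) (hv : 0 ≤ v)
    (hH : H.HasEigenvalues lam) (hr : ∀ i, r i = ‖H.normEigenfun (lam i) a‖) {σ : Finset ℝ}
    (hσ : σ ⊆ (MR ∪ ML) \ (MR ∩ ML)) {κ : Fin N → ℝ}
    (hκ : (lam, κ) ∈ orthantPiece lam {i | r i = 0} (normingValue a lam r (MR ∩ ML ∪ σ))) :
    ∃ K ∈ inverseFamily a lam r, (∀ i, lam i * K.gammaSq (lam i) = κ i) ∧
      ∀ z, K.phiPlus z a = (Real.exp (-a / 2) : ℝ) * aeval z (rootPoly (MR ∩ ML ∪ σ)) := by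
  classical
  obtain ⟨-, hκ1, hκ2⟩ := hκ
  simp only [Set.mem_ofPred_eq] at hκ1 hκ2
  set Λ := MR ∩ ML with hΛ
  set Φ := (MR ∪ ML) \ Λ with hΦ
  set τ : ℝ → ℝ := fun μ => tR μ + tL μ with hτ
  have hΛU : Λ ⊆ MR ∪ ML := Finset.inter_subset_left.trans Finset.subset_union_left
  have hinter : (Λ ∪ σ) ∩ (Λ ∪ Φ \ σ) = Λ := by
    rw [← Finset.union_inter_distrib_left, Finset.inter_sdiff_self, Finset.union_empty]
  have hunion : (Λ ∪ σ) ∪ (Λ ∪ Φ \ σ) = MR ∪ ML := by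
    rw [← Finset.union_union_distrib_left, Finset.union_sdiff_of_subset hσ, hΦ,
      Finset.union_sdiff_of_subset hΛU]
  have h0 : 0 ∉ MR ∪ ML := by simp [h.right_zero, h.left_zero]
  have hR0 : 0 ∉ Λ ∪ σ := fun h1 => h0 (hunion ▸ Finset.mem_union_left _ h1)
  have hL0 : 0 ∉ Λ ∪ Φ \ σ := fun h1 => h0 (hunion ▸ Finset.mem_union_right _ h1)
  have hτpos : ∀ μ ∈ MR ∪ ML, 0 < τ μ := by
    have hnR : ∀ μ, 0 ≤ tR μ := fun μ => by
      by_cases hμ : μ ∈ MR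
      · exact (h.right_pos μ hμ).le
      · exact (h.right_off μ hμ).ge
    have hnL : ∀ μ, 0 ≤ tL μ := fun μ => by
      by_cases hμ : μ ∈ ML
      · exact (h.left_pos μ hμ).le
      · exact (h.left_off μ hμ).ge
    intro μ hμ
    rcases Finset.mem_union.1 hμ with hμ | hμ
    · exact add_pos_of_pos_of_nonneg (h.right_pos μ hμ) (hnL μ)
    · exact add_pos_of_nonneg_of_pos (hnR μ) (h.left_pos μ hμ)
  have hτoff : ∀ μ ∉ MR ∪ ML, τ μ = 0 := by
    intro μ hμ
    simp only [Finset.mem_union, not_or] at hμ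
    simp [hτ, h.right_off μ hμ.1, h.left_off μ hμ.2]
  -- From `residue_ratio` and `gammaSq_eq`, a pair with these poles must satisfy `sR / sL = exp a *
  -- (λᵢ γᵢ²) * q` at a common pole. The absolute value in `ρ` makes the ratio positive before the
  -- sign of `q` is known.
  set q : ℝ → ℝ := fun μ => (derivative (rootPoly (Λ ∪ Φ \ σ))).eval μ /
    (μ * (derivative (eigenPoly lam)).eval μ * (derivative (rootPoly (Λ ∪ σ))).eval μ) with hq
  set ρ : ℝ → ℝ := fun μ => Function.extend lam κ 0 μ * Real.exp a * |q μ| with hρ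
  have hκext : ∀ i, Function.extend lam κ 0 (lam i) = κ i := fun i =>
    hH.1.injective.extend_apply _ _ i
  have hΛi : ∀ {i}, lam i ∈ Λ ↔ r i = 0 := by
    intro i
    rw [h.mem_inter_iff hH, hr, norm_eq_zero]
    constructor
    · rintro ⟨j, hj, hji⟩
      rwa [hji] at hj
    · exact fun hi => ⟨i, hi, rfl⟩
  have hqne : ∀ {i}, r i = 0 → q (lam i) ≠ 0 := fun {i} hi =>
    div_ne_zero (eval_derivative_rootPoly_ne_zero hL0 (Finset.mem_union_left _ (hΛi.2 hi)))
      (mul_ne_zero (mul_ne_zero (hH.ne_zero i) (hH.eval_derivative_ne_zero i))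
        (eval_derivative_rootPoly_ne_zero hR0 (Finset.mem_union_left _ (hΛi.2 hi))))
  have hρpos : ∀ μ ∈ Λ, 0 < ρ μ := by
    intro μ hμ
    obtain ⟨i, -, rfl⟩ := (h.mem_inter_iff hH μ).1 hμ
    have hi := hΛi.1 hμ
    simp only [hρ, hκext]
    exact mul_pos (mul_pos (hκ2 i hi) (Real.exp_pos a)) (abs_pos.2 (hqne hi))
  -- At common poles the total residue is divided in the ratio `ρ : 1`. Off `Λ ∪ σ` all of `τ` goes
  -- to the left, which is harmless elsewhere since `τ` vanishes off the union.
  set sR : ℝ → ℝ := fun μ => if μ ∈ Λ then τ μ * (ρ μ / (1 + ρ μ)) else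
    if μ ∈ σ then τ μ else 0 with hsR
  set sL : ℝ → ℝ := fun μ => if μ ∈ Λ then τ μ * (1 / (1 + ρ μ)) else
    if μ ∈ σ then 0 else τ μ with hsL
  have hsum : (fun μ => sR μ + sL μ) = τ := by
    funext μ
    simp only [hsR, hsL]
    split_ifs with h1 h2
    · have := hρpos μ h1
      field_simp
      ring
    · ring
    · ring
  have hsRpos : ∀ μ ∈ Λ ∪ σ, 0 < sR μ := by
    intro μ hμ
    have h1 := hτpos μ (hunion ▸ Finset.mem_union_left _ hμ)
    simp only [hsR]
    split_ifs with h2 h3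
    · have := hρpos μ h2
      positivity
    · exact h1
    · exact absurd (Finset.mem_union.1 hμ) (by tauto)
  have hsLpos : ∀ μ ∈ Λ ∪ Φ \ σ, 0 < sL μ := by
    intro μ hμ
    have h1 := hτpos μ (hunion ▸ Finset.mem_union_right _ hμ)
    simp only [hsL]
    split_ifs with h2 h3
    · have := hρpos μ h2
      positivity
    · exact absurd hμ (by simp [h2, h3])
    · exact h1
  have hsRoff : ∀ μ ∉ Λ ∪ σ, sR μ = 0 := by
    intro μ hμ
    rw [Finset.mem_union, not_or] at hμ
    simp only [hsR, hμ.1, hμ.2, if_false]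
  have hsLoff : ∀ μ ∉ Λ ∪ Φ \ σ, sL μ = 0 := by
    intro μ hμ
    rw [Finset.mem_union, Finset.mem_sdiff, not_or] at hμ
    simp only [hsL, hμ.1, if_false]
    split_ifs with h2
    · rfl
    · exact hτoff μ fun h3 => hμ.2 ⟨Finset.mem_sdiff.2 ⟨h3, hμ.1⟩, h2⟩
  obtain ⟨K, hK⟩ := exists_of_splitting a hR0 hL0 hsRpos hsLpos hsRoff hsLoff hv (w := w)
  have hchar : (sol K.toList).2 = (sol H.toList).2 := by
    rw [hK.charPoly_eq_mul, h.charPoly_eq_mul, hinter, hunion, hsum]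
  have hKe : K.HasEigenvalues lam :=
    hasEigenvalues_of_eq hH.1 hH.zero_notMem (hchar.trans hH.charPoly_eq)
  have hKn : ∀ i, ‖K.normEigenfun (lam i) a‖ = r i := by
    intro i
    have h1 := hK.norm_normEigenfun_sq_mul hKe i
    have h2 := h.norm_normEigenfun_sq_mul hH i
    rw [rootPoly_mul_rootPoly, hinter, hunion, hΛ, ← rootPoly_mul_rootPoly, ← h2] at h1
    have h3 := mul_right_cancel₀ (mul_ne_zero (hH.ne_zero i) (hH.eval_derivative_ne_zero i)) h1
    rw [hr]
    exact (pow_left_inj₀ (norm_nonneg _) (norm_nonneg _) two_ne_zero).1 h3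
  refine ⟨K, ⟨hKe, hKn⟩, fun i => ?_, hK.phiPlus_eq⟩
  by_cases hi : r i = 0
  · have hmem := hΛi.2 hi
    have hmR : lam i ∈ Λ ∪ σ := Finset.mem_union_left _ hmem
    have hmL : lam i ∈ Λ ∪ Φ \ σ := Finset.mem_union_left _ hmem
    have h1 := hK.residue_ratio _ (hKe.eval_charPoly i) ((eval_rootPoly_eq_zero hR0).2 hmR)
    rw [eval_residuePoly hR0 hmR, eval_residuePoly hL0 hmL] at h1
    have hpos := hKe.gammaSq_pos i
    have hγ := hKe.gammaSq_eq i
    have hρi : ρ (lam i) = κ i * Real.exp a * |q (lam i)| := by simp only [hρ, hκext]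
    have hρp := hρpos _ hmem
    have hsRi : sR (lam i) = ρ (lam i) * sL (lam i) := by
      simp only [hsR, hsL, hmem, if_true]
      ring
    have hsLi : sL (lam i) ≠ 0 := (hK.left_pos _ hmL).ne'
    have hdR := eval_derivative_rootPoly_ne_zero hR0 hmR
    have hW := hH.eval_derivative_ne_zero i
    have hl := hH.ne_zero i
    have hqq := hqne hi
    have hqi : q (lam i) * (lam i * (derivative (eigenPoly lam)).eval (lam i) *
        (derivative (rootPoly (Λ ∪ σ))).eval (lam i)) =
        (derivative (rootPoly (Λ ∪ Φ \ σ))).eval (lam i) := by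
      simp only [hq]
      field_simp
    rw [hsRi, hρi] at h1
    have h2 : κ i * |q (lam i)| * (derivative (rootPoly (Λ ∪ σ))).eval (lam i) =
        -(lam i * (sol K.toList).1.eval (lam i)) *
          (derivative (rootPoly (Λ ∪ Φ \ σ))).eval (lam i) := by
      refine mul_left_cancel₀ (mul_ne_zero (Real.exp_ne_zero a) hsLi) ?_
      linear_combination -h1
    have h3 : κ i * |q (lam i)| = lam i * K.gammaSq (lam i) * q (lam i) := by
      refine mul_right_cancel₀ hdR ?_
      rw [h2, hγ, ← hqi]
      ring
    -- The constructed pair has `λᵢ γᵢ² > 0`, which rules out a negative `q` and removes the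
    -- absolute value.
    rcases hqq.lt_or_gt with hneg | hqpos
    · have h4 := mul_pos (hκ2 i hi) (abs_pos.2 hqq)
      have h5 := mul_neg_of_pos_of_neg hpos hneg
      linarith
    · rw [abs_of_pos hqpos] at h3
      exact (mul_right_cancel₀ hqq h3).symm
  · rw [hK.eq_normingValue hKe (hKn i) hi, hκ1 i hi]

end IsSplitting

/-- The spectral data of the inverse family, as a union of orthants. -/
theorem inverseFamilyData_eq {H : DiscretePair} {a : ℝ} {MR ML : Finset ℝ} {tR tL : ℝ → ℝ}
    {w v : ℝ} {N : ℕ} {lam r : Fin N → ℝ} (h : H.IsSplitting a MR ML tR tL w v) (hv : 0 ≤ v)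
    (hH : H.HasEigenvalues lam) (hr : ∀ i, r i = ‖H.normEigenfun (lam i) a‖) :
    inverseFamilyData a lam r = ⋃ σ : ((MR ∪ ML) \ (MR ∩ ML)).powerset,
      orthantPiece lam {i | r i = 0} (normingValue a lam r (MR ∩ ML ∪ σ)) := by
  ext q
  rw [Set.mem_iUnion]
  constructor
  · rintro ⟨K, hK, rfl⟩
    obtain ⟨σ, hσ, hmem⟩ := h.mem_orthantPiece hH hr hK
    exact ⟨⟨σ, Finset.mem_powerset.2 hσ⟩, hmem⟩
  · rintro ⟨⟨σ, hσ⟩, hq⟩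
    obtain ⟨l, κ⟩ := q
    obtain rfl : l = lam := hq.1
    obtain ⟨K, hK, hκ, -⟩ :=
      h.exists_of_mem_orthantPiece hv hH hr (Finset.mem_powerset.1 hσ) hq
    exact ⟨K, hK, Prod.ext rfl (funext hκ)⟩

/-- A common point would be realized by two pairs with the same spectral data, which coincide by
`eq_of_gammaSq_eq`. The zeros of `z ↦ φ₊(z, a)` then recover `σ`. -/
theorem disjoint_orthantPieces {H : DiscretePair} {a : ℝ} {MR ML : Finset ℝ} {tR tL : ℝ → ℝ}
    {w v : ℝ} {N : ℕ} {lam r : Fin N → ℝ} (h : H.IsSplitting a MR ML tR tL w v) (hv : 0 ≤ v)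
    (hH : H.HasEigenvalues lam) (hr : ∀ i, r i = ‖H.normEigenfun (lam i) a‖)
    (σ σ' : ((MR ∪ ML) \ (MR ∩ ML)).powerset) (hne : σ ≠ σ') :
    Disjoint (orthantPiece lam {i | r i = 0} (normingValue a lam r (MR ∩ ML ∪ σ)))
      (orthantPiece lam {i | r i = 0} (normingValue a lam r (MR ∩ ML ∪ σ'))) := by
  obtain ⟨σ, hσ⟩ := σ
  obtain ⟨σ', hσ'⟩ := σ'
  rw [Finset.mem_powerset] at hσ hσ'
  rw [Set.disjoint_left]
  rintro ⟨l, κ⟩ hq hq'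
  obtain rfl : l = lam := hq.1
  refine hne (Subtype.ext ?_)
  obtain ⟨K, hK, hκ, hφ⟩ := h.exists_of_mem_orthantPiece hv hH hr hσ hq
  obtain ⟨K', hK', hκ', hφ'⟩ := h.exists_of_mem_orthantPiece hv hH hr hσ' hq'
  obtain rfl : K = K' := hK.1.eq_of_gammaSq_eq hK'.1 fun i => by rw [hκ, hκ']
  have h0 : 0 ∉ MR ∪ ML := by simp [h.right_zero, h.left_zero]
  have hsub : ∀ {s : Finset ℝ}, s ⊆ (MR ∪ ML) \ (MR ∩ ML) → 0 ∉ MR ∩ ML ∪ s := by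
    intro s hs h1
    rcases Finset.mem_union.1 h1 with h1 | h1
    · exact h.right_zero (Finset.mem_inter.1 h1).1
    · exact h0 (Finset.mem_sdiff.1 (hs h1)).1
  have hpoly : rootPoly (MR ∩ ML ∪ σ) = rootPoly (MR ∩ ML ∪ σ') := by
    refine Polynomial.funext fun x => ?_
    have h1 := (hφ x).symm.trans (hφ' x)
    have h2 := mul_left_cancel₀ (by exact_mod_cast Real.exp_ne_zero _) h1
    have h3 : ∀ p : ℝ[X], aeval (x : ℂ) p = ((p.eval x : ℝ) : ℂ) := fun p => by
      rw [← coe_aeval_eq_eval]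
      exact aeval_algebraMap_apply ℂ x _
    rwa [h3, h3, Complex.ofReal_inj] at h2
  have heq := rootPoly_injective (hsub hσ) (hsub hσ') hpoly
  have hrec : ∀ {s : Finset ℝ}, s ⊆ (MR ∪ ML) \ (MR ∩ ML) → (MR ∩ ML ∪ s) \ (MR ∩ ML) = s := by
    intro s hs
    rw [Finset.union_sdiff_left]
    exact Finset.sdiff_eq_self_of_disjoint
      (Finset.disjoint_of_subset_left hs Finset.sdiff_disjoint)
  exact (hrec hσ).symm.trans ((congrArg (· \ (MR ∩ ML)) heq).trans (hrec hσ'))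

end DiscretePair

theorem theorem3p15 (a : ℝ) (H : DiscretePair) (N : ℕ) (lam : Fin N → ℝ)
    (hlam : H.HasEigenvalues lam) (k : ℕ)
    (hk : Set.ncard {i | H.normEigenfun (lam i) a = 0} = k)
    (r : Fin N → ℝ) (hr : ∀ i, r i = ‖H.normEigenfun (lam i) a‖)
    (α β : ℝ) (hα : α = 1 - ∑ i, r i ^ 2) (hβ : β = -∑ i, lam i * r i ^ 2) :
    (1 ≤ k → (DiscretePair.inverseFamily a lam r).Infinite) ∧
    (α = 0 → β = 0 → 2 * k + 2 ≤ N ∧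
      IsDisjointManifolds (2 ^ (N - 2 * k - 2)) k (DiscretePair.inverseFamilyData a lam r)) ∧
    (α = 0 → β ≠ 0 → 2 * k + 1 ≤ N ∧
      IsDisjointManifolds (2 ^ (N - 2 * k - 1)) k (DiscretePair.inverseFamilyData a lam r)) ∧
    (α ≠ 0 → 2 * k ≤ N ∧
      IsDisjointManifolds (2 ^ (N - 2 * k)) k (DiscretePair.inverseFamilyData a lam r)) := by
  obtain ⟨MR, ML, tR, tL, w, v, hv, h⟩ := H.exists_isSplitting a
  have hZ : {i | H.normEigenfun (lam i) a = 0} = {i | r i = 0} := by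
    ext i
    simp [hr]
  have hinter : (MR ∩ ML).card = k := by
    have h1 : ((MR ∩ ML : Finset ℝ) : Set ℝ) = lam '' {i | H.normEigenfun (lam i) a = 0} := by
      ext x
      rw [Finset.mem_coe, h.mem_inter_iff hlam]
      rfl
    rw [← Set.ncard_coe_finset, h1, Set.ncard_image_of_injective _ hlam.1.injective, hk]
  -- Each common zero is counted twice in the degree of the product. The symmetric difference that
  -- remains gives the exponent `m`, and in particular `m ≥ 0`.
  have hcard : ((MR ∪ ML) \ (MR ∩ ML)).card + 2 * k = MR.card + ML.card := by
    have h1 := Finset.card_union_add_card_inter MR ML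
    have h2 := Finset.card_sdiff_add_card_eq_card
      (Finset.inter_subset_left.trans Finset.subset_union_left : MR ∩ ML ⊆ MR ∪ ML)
    omega
  have hdata := DiscretePair.inverseFamilyData_eq h hv hlam hr
  have hman := isDisjointManifolds_of_orthantPieces hdata
    (DiscretePair.disjoint_orthantPieces h hv hlam hr)
  rw [Fintype.card_coe, Finset.card_powerset, ← hZ, hk] at hman
  simp only [hr] at hα hβ
  obtain ⟨c1, c2, c3⟩ := h.card_add_card_eq hlam hα hβ
  refine ⟨fun hk1 => ?_, fun h1 h2 => ?_, fun h1 h2 => ?_, fun h1 => ?_⟩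
  · have hne : {i | r i = 0}.Nonempty := by
      rw [← hZ]
      exact Set.nonempty_of_ncard_ne_zero (by omega)
    refine Set.Infinite.of_image (fun K : DiscretePair => (lam, fun i => lam i * K.gammaSq (lam i))) ?_
    change (DiscretePair.inverseFamilyData a lam r).Infinite
    rw [hdata]
    refine (infinite_orthantPiece _ hne).mono (Set.subset_iUnion_of_subset
      ⟨∅, Finset.empty_mem_powerset _⟩ le_rfl)
  · have := c3 h1 h2
    refine ⟨by omega, ?_⟩
    rwa [show N - 2 * k - 2 = ((MR ∪ ML) \ (MR ∩ ML)).card by omega]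
  · have := c2 h1 h2
    refine ⟨by omega, ?_⟩
    rwa [show N - 2 * k - 1 = ((MR ∪ ML) \ (MR ∩ ML)).card by omega]
  · have := c1 h1
    refine ⟨by omega, ?_⟩
    rwa [show N - 2 * k = ((MR ∪ ML) \ (MR ∩ ML)).card by omega]
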